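/- For $n\ge 1$ let $D\in\mathbb{C}^{n\times n}$ be the unitary DFT matrix, $D_{i,j}=n^{-1/2}e^{-2\pi \mathbf{i}(i-1)(j-1)/n}$. For $x\in\mathbb{C}^n$ let $S_1$ and $S_2$ be the sets of indices of the nonzero entries of $x$ and of $Dx$, respectively. A set $S\subseteq\{1,\dots,n\}$ is called $l$-periodic if $l$ divides $n$ and, for every $i$, one has $i\in S$ if and only if $j\in S$ for all $j\in\{1,\dots,n\}$ with $j\equiv i \pmod l$. Given $A\in\mathbb{C}^{m\times n}$ and $\lambda>0$, Joint Basis Pursuit (JBP) with parameter $\lambda$ is the problem $$\min_{\hat x\in\mathbb{C}^n}\ \|\hat x\|_1+\lambda\|D\hat x\|_1\quad\text{subject to}\quad A\hat x=Ax,$$ and it is said to recover $x$ if $x$ is its unique minimizer. **Theorem.** There is an absolute constant $C>0$ such that for every $\alpha\in[0,1)$ and every $\varepsilon>0$ there is an $N$ such that the following holds for all $n\ge N$. Let $n=n_1n_2$ with positive integers $n_1,n_2$, and let $x\in\mathbb{C}^n$ be a fixed vector such that $S_1$ is $n_1$-periodic, $S_2$ is $n_2$-periodic, and $$|S_1|\le|S_2|,\qquad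 |S_1|\le\frac{n}{\log n},\qquad |S_2|\le|S_1|(\log n)^{\alpha}.$$ Let $A\in\mathbb{C}^{m\times n}$ have i.i.d. centred circularly symmetric complex Gaussian entries of some positive variance. 1. If $|S_2|\le|S_1|\log\log n$ and $m\ge C|S_2|\log\log n$, then JBP with $\lambda=1$ recovers $x$ with probability at least $1-\varepsilon$. 2. If $|S_2|\ge|S_1|\log\log n$ and $m\ge C|S_2|$, then JBP with $\lambda=1/\log n$ recovers $x$ with probability at least $1-\varepsilon$. In particular, $m=O(|S_2|\log\log n)$, respectively $m=O(|S_2|)$, measurements suffice for recovery with high probability. -/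

import Mathlib

open scoped NNReal ENNReal

noncomputable section

namespace JBP

/-- The unitary DFT matrix, with rows and columns indexed from `0`. -/
def dft (n : ℕ) : Matrix (Fin n) (Fin n) ℂ := fun i j =>
  Complex.exp (-(2 * (Real.pi : ℂ) * Complex.I) / (n : ℂ)) ^ ((i : ℕ) * (j : ℕ)) /
    ((Real.sqrt (n : ℝ) : ℝ) : ℂ)

/-- The `ℓ₁` norm on `ℂⁿ`. -/
def l1Norm {n : ℕ} (v : Fin n → ℂ) : ℝ := ∑ i, ‖v i‖

/-- The support of `x` in the basis `U`: the locations of the nonzero entries of `U x`. -/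
def supp {n : ℕ} (U : Matrix (Fin n) (Fin n) ℂ) (x : Fin n → ℂ) : Finset (Fin n) :=
  Finset.univ.filter fun i => U.mulVec x i ≠ 0

/-- `S` is an `l`-periodic subset of the index set. Shifting the indices from `1, …, n` to
`0, …, n - 1` does not affect congruences. -/
def IsPeriodic {n : ℕ} (l : ℕ) (S : Finset (Fin n)) : Prop :=
  l ∣ n ∧ ∀ i : Fin n, i ∈ S ↔ ∀ j : Fin n, (j : ℕ) ≡ (i : ℕ) [MOD l] → j ∈ S

/-- The cost function of Joint Basis Pursuit. -/
def cost {n : ℕ} (U₁ U₂ : Matrix (Fin n) (Fin n) ℂ) (lam : ℝ) (x : Fin n → ℂ) : ℝ :=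
  l1Norm (U₁.mulVec x) + lam * l1Norm (U₂.mulVec x)

/-- Joint Basis Pursuit recovers `x` from `A x`: among all `y` with `A y = A x`, the vector `x`
is the unique minimizer of the cost. -/
def Recovers {m n : ℕ} (U₁ U₂ : Matrix (Fin n) (Fin n) ℂ) (lam : ℝ)
    (A : Matrix (Fin m) (Fin n) ℂ) (x : Fin n → ℂ) : Prop :=
  ∀ y : Fin n → ℂ, A.mulVec y = A.mulVec x → y ≠ x → cost U₁ U₂ lam x < cost U₁ U₂ lam y

/-- The centred circular complex Gaussian law of variance `v`: real and imaginary parts are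
independent real Gaussians of variance `v / 2`. -/
def complexGaussian (v : ℝ≥0) : MeasureTheory.Measure ℂ :=
  ((ProbabilityTheory.gaussianReal 0 (v / 2)).prod
    (ProbabilityTheory.gaussianReal 0 (v / 2))).map fun p : ℝ × ℝ => (⟨p.1, p.2⟩ : ℂ)

/-- The law of an `m × n` matrix with i.i.d. complex Gaussian entries of variance `v`. -/
def gaussianMatrix (m n : ℕ) (v : ℝ≥0) : MeasureTheory.Measure (Fin m → Fin n → ℂ) :=
  MeasureTheory.Measure.pi fun _ : Fin m =>
    MeasureTheory.Measure.pi fun _ : Fin n => complexGaussian v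

end JBP

end

/-! Recovery fails only if some nonzero `h = y - x` in the kernel of `A` does not increase the cost.
Such an `h` satisfies `‖h‖₁ + λ‖Dh‖₁ ≤ R‖h‖₂` with `R` of order `√|S₁| + λ√|S₂|`
(`cost_sub_le_of_cost_le`), so it suffices that a Gaussian kernel misses this part of the unit
sphere. By escape through a mesh (`measure_exists_forall_eq_zero_le`) this holds once `m` dominates
the squared mean width.

The width bound (`exists_integrable_bound_reDot`) uses both bases. A Gaussian vector `g` is split
into its coordinates clipped at `t`, of order `√(log log n)`, and a residual. The clipped part is
paired with `h` at the price `t‖h‖₁`. The residual has variance of order `exp(-t²/2) = (log n)⁻⁴`,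
so all `n` of its Fourier coefficients are `O(1 / log n)` in mean; pairing on the Fourier side costs
`‖Dh‖₁ / log n`, which `λ ≥ 1 / log n` absorbs. The squared width is thus `O(R² log log n)`, where
`R = 4√|S₂|` for `λ = 1` and `R = 4√|S₁|` for `λ = 1 / log n`.

The escape bound has failure probability `O(1/m)`. It tends to zero because the uncertainty
principle forces `|S₂| ≥ √n`. -/

noncomputable section

namespace JBP

open MeasureTheory ProbabilityTheory Matrix

/-! ### Finite suprema. -/

section FiniteSup

variable {ι Ω : Type*} [Finite ι] [MeasurableSpace Ω] {μ : Measure Ω}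

lemma le_iSup_of_finite (f : ι → ℝ) (i : ι) : f i ≤ ⨆ j, f j :=
  le_ciSup (Set.finite_range f).bddAbove i

lemma abs_iSup_le_sum [Fintype ι] [Nonempty ι] (f : ι → ℝ) : |⨆ i, f i| ≤ ∑ i, |f i| := by
  obtain ⟨i, hi⟩ := exists_eq_ciSup_of_finite (f := f)
  rw [← hi]
  exact Finset.single_le_sum (f := fun j => |f j|) (fun j _ => abs_nonneg _) (Finset.mem_univ i)

lemma integrable_iSup [Nonempty ι] {f : ι → Ω → ℝ} (hf : ∀ i, Integrable (f i) μ)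
    (hm : ∀ i, Measurable (f i)) : Integrable (fun x => ⨆ i, f i x) μ := by
  cases nonempty_fintype ι
  refine Integrable.mono' (integrable_finsetSum Finset.univ fun i _ => (hf i).abs)
    (Measurable.iSup hm).aestronglyMeasurable (.of_forall fun x => ?_)
  simpa using abs_iSup_le_sum fun i => f i x

/-- Two-point contraction: a `1`-Lipschitz function can be removed from a symmetrized pair of
suprema. -/
lemma iSup_add_iSup_le_of_lipschitz [Nonempty ι] {φ : ℝ → ℝ} (hφ : LipschitzWith 1 φ)
    (A u : ι → ℝ) :
    (⨆ i, (A i + 2 * φ (u i))) + ⨆ i, (A i - 2 * φ (u i)) ≤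
      (⨆ i, (A i + 2 * u i)) + ⨆ i, (A i - 2 * u i) := by
  obtain ⟨i, hi⟩ := exists_eq_ciSup_of_finite (f := fun i => A i + 2 * φ (u i))
  obtain ⟨j, hj⟩ := exists_eq_ciSup_of_finite (f := fun i => A i - 2 * φ (u i))
  rw [← hi, ← hj]
  have hL : |φ (u i) - φ (u j)| ≤ |u i - u j| := by
    simpa [Real.dist_eq] using hφ.dist_le_mul (u i) (u j)
  have h1 := le_iSup_of_finite (fun i => A i + 2 * u i) i
  have h2 := le_iSup_of_finite (fun i => A i + 2 * u i) j
  have h3 := le_iSup_of_finite (fun i => A i - 2 * u i) i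
  have h4 := le_iSup_of_finite (fun i => A i - 2 * u i) j
  have h5 := (le_abs_self _).trans hL
  -- If `u i ≥ u j`, test the plus supremum at `i` and the minus one at `j`; otherwise swap them.
  rcases abs_cases (u i - u j) with h | h <;> linarith

end FiniteSup

/-! ### Gaussian symmetrization and contraction. -/

section Contraction

lemma integrable_lipschitz_comp_dual {E : Type*} [NormedAddCommGroup E] [NormedSpace ℝ E]
    [MeasurableSpace E] [BorelSpace E] {μ : Measure E} [IsGaussian μ] {φ : ℝ → ℝ}
    (hφ : LipschitzWith 1 φ) (L : StrongDual ℝ E) :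
    Integrable (fun x => φ (L x)) μ := by
  refine Integrable.mono' ((integrable_const |φ 0|).add (IsGaussian.integrable_dual μ L).abs)
    (hφ.continuous.comp L.continuous).aestronglyMeasurable (.of_forall fun x => ?_)
  have h : |φ (L x) - φ 0| ≤ |L x - 0| := by
    simpa [Real.dist_eq] using hφ.dist_le_mul (L x) 0
  simp only [Real.norm_eq_abs, Pi.add_apply]
  have := abs_sub_abs_le_abs_sub (φ (L x)) (φ 0)
  simp only [sub_zero] at h
  linarith

variable {ι E : Type*} [Finite ι] [Nonempty ι] [NormedAddCommGroup E] [NormedSpace ℝ E]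
  [MeasurableSpace E] [BorelSpace E] [SecondCountableTopology E] [CompleteSpace E]
  {μ : Measure E} [IsGaussian μ]

/-- Rotation invariance of a pair of independent copies, read off in one component. The angle `π`
gives symmetry under negation; a general angle merges two independent Gaussians into one. -/
lemma measurePreserving_rotation_fst (hμ : ∫ x, x ∂μ = 0) (θ : ℝ) :
    MeasurePreserving (fun p : E × E => Real.cos θ • p.1 + Real.sin θ • p.2) (μ.prod μ) μ := by
  refine ⟨by fun_prop, ?_⟩
  have h := congrArg (Measure.map Prod.fst) (IsGaussian.map_rotation_eq_self (μ := μ) hμ θ)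
  rw [Measure.map_map (by fun_prop) (by fun_prop)] at h
  simpa [Function.comp_def, ContinuousLinearMap.rotation_apply] using h

lemma measurePreserving_neg_of_isGaussian (hμ : ∫ x, x ∂μ = 0) :
    MeasurePreserving (fun x : E => -x) μ μ := by
  have h := measurePreserving_rotation_fst hμ Real.pi
  refine ⟨by fun_prop, ?_⟩
  have h2 := h.map_eq
  rw [show (fun p : E × E => Real.cos Real.pi • p.1 + Real.sin Real.pi • p.2) =
    (fun x => -x) ∘ Prod.fst by ext p; simp, ← Measure.map_map (by fun_prop) (by fun_prop)] at h2
  simpa using h2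

/-- Symmetrization and contraction for a single Gaussian vector. -/
lemma integral_iSup_sub_lipschitz_le (hμ : ∫ x, x ∂μ = 0) {φ : ℝ → ℝ} (hφ : LipschitzWith 1 φ)
    (A : ι → ℝ) (u : ι → StrongDual ℝ E) :
    ∫ x, ⨆ i, (A i + ((∫ y, φ (u i y) ∂μ) - φ (u i x))) ∂μ ≤
      ∫ x, ⨆ i, (A i + 2 * u i x) ∂μ := by
  have hφi i := integrable_lipschitz_comp_dual (μ := μ) hφ (u i)
  have hui i := IsGaussian.integrable_dual μ (u i)
  have hφm : Measurable φ := hφ.continuous.measurable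
  have I0 : Integrable (fun x => ⨆ i, (A i + ((∫ y, φ (u i y) ∂μ) - φ (u i x)))) μ :=
    integrable_iSup (fun i => (integrable_const _).add ((integrable_const _).sub (hφi i)))
      (fun i => by fun_prop)
  have I1 : Integrable (fun x => ⨆ i, (A i + 2 * φ (u i x))) μ :=
    integrable_iSup (fun i => (integrable_const _).add ((hφi i).const_mul 2))
      (fun i => by fun_prop)
  have I2 : Integrable (fun x => ⨆ i, (A i - 2 * φ (u i x))) μ :=
    integrable_iSup (fun i => (integrable_const _).sub ((hφi i).const_mul 2))
      (fun i => by fun_prop)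
  have I3 : Integrable (fun x => ⨆ i, (A i + 2 * u i x)) μ :=
    integrable_iSup (fun i => (integrable_const _).add ((hui i).const_mul 2))
      (fun i => by fun_prop)
  have I4 : Integrable (fun x => ⨆ i, (A i - 2 * u i x)) μ :=
    integrable_iSup (fun i => (integrable_const _).sub ((hui i).const_mul 2))
      (fun i => by fun_prop)
  -- Splitting `A i` into two halves separates the averaged term from the random one, so no joint
  -- supremum over an independent copy is needed.
  have key : ∀ x, ⨆ i, (A i + ((∫ y, φ (u i y) ∂μ) - φ (u i x))) ≤
      (1 / 2) * (∫ y, ⨆ i, (A i + 2 * φ (u i y)) ∂μ) +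
        (1 / 2) * ⨆ i, (A i - 2 * φ (u i x)) := by
    intro x
    refine ciSup_le fun i => ?_
    have h1 : ∫ y, (A i + 2 * φ (u i y)) ∂μ ≤ ∫ y, ⨆ i, (A i + 2 * φ (u i y)) ∂μ :=
      integral_mono ((integrable_const _).add ((hφi i).const_mul 2)) I1
        (fun y => le_iSup_of_finite (fun i => A i + 2 * φ (u i y)) i)
    rw [integral_add (integrable_const _) ((hφi i).const_mul 2), integral_const_mul] at h1
    simp only [integral_const, probReal_univ, one_smul] at h1
    have h2 := le_iSup_of_finite (fun i => A i - 2 * φ (u i x)) i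
    linarith
  have hneg : ∫ x, ⨆ i, (A i - 2 * u i x) ∂μ = ∫ x, ⨆ i, (A i + 2 * u i x) ∂μ := by
    have h := (measurePreserving_neg_of_isGaussian hμ).integral_comp
      (MeasurableEquiv.neg E).measurableEmbedding (fun x => ⨆ i, (A i + 2 * u i x))
    rw [← h]
    simp [sub_eq_add_neg]
  have hc : ∫ x, ((⨆ i, (A i + 2 * φ (u i x))) + ⨆ i, (A i - 2 * φ (u i x))) ∂μ ≤
      ∫ x, ((⨆ i, (A i + 2 * u i x)) + ⨆ i, (A i - 2 * u i x)) ∂μ :=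
    integral_mono (I1.add I2) (I3.add I4)
      (fun x => iSup_add_iSup_le_of_lipschitz hφ A (fun i => u i x))
  rw [integral_add I1 I2, integral_add I3 I4, hneg] at hc
  have hk := integral_mono I0 ((integrable_const _).add (I2.const_mul (1 / 2))) key
  simp only [Pi.add_apply] at hk
  rw [integral_add (integrable_const _) (I2.const_mul (1 / 2))] at hk
  simp only [integral_const, probReal_univ, one_smul] at hk
  rw [integral_const_mul] at hk
  linarith

/-- For independent copies, `√m X + Y` has the law of `√(m + 1) X`: this is where the factor `√m` in
the induction on samples comes from. -/
lemma integral_prod_iSup_add_eq {ι E : Type*} [Finite ι] [NormedAddCommGroup E]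
    [NormedSpace ℝ E] [MeasurableSpace E] [BorelSpace E] [SecondCountableTopology E]
    [CompleteSpace E] {μ : Measure E} [IsGaussian μ] (hμ : ∫ x, x ∂μ = 0) (A : ι → ℝ)
    (u : ι → StrongDual ℝ E) (m : ℕ) :
    ∫ p, ⨆ i, (A i + 2 * √m * u i p.1 + 2 * u i p.2) ∂(μ.prod μ) =
      ∫ x, ⨆ i, (A i + 2 * √(m + 1 : ℕ) * u i x) ∂μ := by
  obtain ⟨θ, hc, hs⟩ : ∃ θ : ℝ, √(m + 1 : ℕ) * Real.cos θ = √m ∧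
      √(m + 1 : ℕ) * Real.sin θ = 1 := by
    have hp : 0 < √((m + 1 : ℕ) : ℝ) := Real.sqrt_pos.2 (by positivity)
    refine ⟨Real.arcsin (1 / √(m + 1 : ℕ)), ?_, ?_⟩
    · rw [Real.cos_arcsin, ← Real.sqrt_mul (by positivity)]
      congr 1
      rw [div_pow, Real.sq_sqrt (by positivity)]
      push_cast
      field_simp
      ring
    · have h1 : 1 ≤ √((m + 1 : ℕ) : ℝ) := by
        rw [Real.one_le_sqrt]; push_cast; linarith [Nat.cast_nonneg (α := ℝ) m]
      rw [Real.sin_arcsin (by linarith [show 0 ≤ 1 / √((m + 1 : ℕ) : ℝ) by positivity])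
        (by rwa [div_le_one hp])]
      field_simp
  have h := measurePreserving_rotation_fst (μ := μ) hμ θ
  have hmeas : Measurable (fun x => ⨆ i, (A i + 2 * √(m + 1 : ℕ) * u i x)) :=
    Measurable.iSup fun i => by fun_prop
  have hmap := integral_map (μ := μ.prod μ) h.measurable.aemeasurable hmeas.aestronglyMeasurable
  rw [h.map_eq] at hmap
  rw [hmap]
  refine integral_congr_ae (.of_forall fun p => ?_)
  dsimp only
  refine iSup_congr fun i => ?_
  simp only [map_add, map_smul, smul_eq_mul]
  linear_combination (-2 * u i p.1) * hc + (-2 * u i p.2) * hs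

/-- Symmetrization and contraction for `m` independent copies of a centred Gaussian vector. -/
lemma integral_iSup_sum_sub_lipschitz_le (hμ : ∫ x, x ∂μ = 0) {φ : ℝ → ℝ}
    (hφ : LipschitzWith 1 φ) (u : ι → StrongDual ℝ E) (m : ℕ) (A : ι → ℝ) :
    ∫ x, ⨆ i, (A i + ∑ k, ((∫ y, φ (u i y) ∂μ) - φ (u i (x k)))) ∂(Measure.pi fun _ : Fin m => μ)
      ≤ ∫ x, ⨆ i, (A i + 2 * √m * u i x) ∂μ := by
  have hφi i := integrable_lipschitz_comp_dual (μ := μ) hφ (u i)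
  have hui i := IsGaussian.integrable_dual μ (u i)
  have hφm : Measurable φ := hφ.continuous.measurable
  induction m generalizing A with
  | zero => simp
  | succ m ih =>
    set c : ι → ℝ := fun i => ∫ y, φ (u i y) ∂μ with hcdef
    have hmp := measurePreserving_piFinSuccAbove (fun _ : Fin (m + 1) => μ) 0
    have e1 : ∫ x, ⨆ i, (A i + ∑ k, (c i - φ (u i (x k)))) ∂(Measure.pi fun _ : Fin (m + 1) => μ) =
        ∫ p, ⨆ i, ((A i + (c i - φ (u i p.1))) + ∑ k, (c i - φ (u i (p.2 k))))
          ∂(μ.prod (Measure.pi fun _ : Fin m => μ)) := by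
      rw [← hmp.integral_comp (MeasurableEquiv.measurableEmbedding _)]
      congr 1 with x
      congr 1 with i
      rw [Fin.sum_univ_succ, ← add_assoc]
      rfl
    have J1 : Integrable (fun p : E × (Fin m → E) =>
        ⨆ i, ((A i + (c i - φ (u i p.1))) + ∑ k, (c i - φ (u i (p.2 k)))))
          (μ.prod (Measure.pi fun _ : Fin m => μ)) := by
      refine integrable_iSup (fun i => ?_) (fun i => by fun_prop)
      refine ((integrable_const _).add ((integrable_const _).sub ((hφi i).comp_fst _))).add
        (integrable_finsetSum _ fun k _ => (integrable_const _).sub ?_)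
      exact ((measurePreserving_eval (fun _ : Fin m => μ) k).integrable_comp_of_integrable
        (hφi i)).comp_snd μ
    have J2 : Integrable (fun p : E × E =>
        ⨆ i, ((A i + (c i - φ (u i p.1))) + 2 * √m * u i p.2)) (μ.prod μ) := by
      refine integrable_iSup (fun i => ?_) (fun i => by fun_prop)
      exact ((integrable_const _).add ((integrable_const _).sub ((hφi i).comp_fst _))).add
        (((hui i).comp_snd μ).const_mul _)
    have J3 : Integrable (fun p : E × E =>
        ⨆ i, (A i + 2 * √m * u i p.1 + 2 * u i p.2)) (μ.prod μ) := by
      refine integrable_iSup (fun i => ?_) (fun i => by fun_prop)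
      exact ((integrable_const _).add (((hui i).comp_fst μ).const_mul _)).add
        (((hui i).comp_snd μ).const_mul _)
    rw [e1, integral_prod _ J1, ← integral_prod_iSup_add_eq hμ, integral_prod _ J3]
    -- With the first sample frozen, its contribution joins the offset `A`, and the induction
    -- hypothesis replaces the other samples by one Gaussian. After swapping the integrals, that
    -- Gaussian joins the offset instead and the first sample is contracted.
    calc _ ≤ ∫ x, ∫ y, ⨆ i, ((A i + (c i - φ (u i x))) + 2 * √m * u i y) ∂μ ∂μ :=
          integral_mono J1.integral_prod_left J2.integral_prod_left
            (fun x => ih (fun i => A i + (c i - φ (u i x))))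
      _ = ∫ y, ∫ x, ⨆ i, ((A i + (c i - φ (u i x))) + 2 * √m * u i y) ∂μ ∂μ :=
          integral_integral_swap J2
      _ ≤ _ := by
          refine integral_mono J2.integral_prod_right J3.integral_prod_left fun y => ?_
          have h := integral_iSup_sub_lipschitz_le (μ := μ) hμ hφ
            (fun i => A i + 2 * √m * u i y) u
          refine le_of_eq_of_le ?_ h
          congr 1 with x
          congr 1 with i
          ring

end Contraction

/-! ### Variance under bounded differences. -/

/-- The Efron–Stein bound for the variance of a function with bounded differences. -/
lemma integral_sq_sub_integral_le {X : Type*} [MeasurableSpace X] {μ : Measure X}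
    [IsProbabilityMeasure μ] (m : ℕ) (f : (Fin m → X) → ℝ) (hf : Measurable f) (B : ℝ)
    (hB : ∀ x, |f x| ≤ B) (hd : ∀ x k y, |f x - f (Function.update x k y)| ≤ 1) :
    ∫ x, (f x - ∫ z, f z ∂(Measure.pi fun _ : Fin m => μ)) ^ 2
      ∂(Measure.pi fun _ : Fin m => μ) ≤ m := by
  induction m with
  | zero => simp [Subsingleton.elim _ (default : Fin 0 → X)]
  | succ m ih =>
    set ν := Measure.pi fun _ : Fin m => μ
    have hmp := measurePreserving_piFinSuccAbove (fun _ : Fin (m + 1) => μ) 0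
    set F : X × (Fin m → X) → ℝ := fun p => f (Fin.cons p.1 p.2) with hF
    have hcons : Measurable (fun p : X × (Fin m → X) => (Fin.cons p.1 p.2 : Fin (m + 1) → X)) :=
      measurable_pi_lambda _ fun i => by
        refine Fin.cases ?_ (fun j => ?_) i
        · simpa using measurable_fst
        · simp only [Fin.cons_succ]
          fun_prop
    have hFm : Measurable F := hf.comp hcons
    have tr : ∀ G : ℝ → ℝ, ∫ x, G (f x) ∂(Measure.pi fun _ : Fin (m + 1) => μ) =
        ∫ p, G (F p) ∂(μ.prod ν) := by
      intro G
      rw [← hmp.integral_comp (MeasurableEquiv.measurableEmbedding _)]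
      refine integral_congr_ae (.of_forall fun x => ?_)
      simp [hF, MeasurableEquiv.piFinSuccAbove, Fin.insertNthEquiv]
    have hbdd : ∀ {Y : Type _} [MeasurableSpace Y] (ρ : Measure Y) [IsProbabilityMeasure ρ]
        (g : Y → ℝ) (K : ℝ), Measurable g → (∀ y, |g y| ≤ K) → Integrable g ρ := by
      intro Y _ ρ _ g K hg hK
      exact Integrable.of_bound hg.aestronglyMeasurable K (.of_forall hK)
    -- Averaging out the first coordinate keeps the bounded differences, so induction applies to
    -- `g`, while `F - g` is bounded by `1`.
    set g : (Fin m → X) → ℝ := fun r => ∫ a, F (a, r) ∂μ with hg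
    have hgm : Measurable g :=
      (StronglyMeasurable.integral_prod_left hFm.stronglyMeasurable).measurable
    have hFr : ∀ r, Integrable (fun a => F (a, r)) μ := fun r =>
      hbdd μ _ B (by fun_prop) (fun a => hB _)
    have hgB : ∀ r, |g r| ≤ B := fun r => by
      have := norm_integral_le_of_norm_le_const (μ := μ) (f := fun a => F (a, r)) (C := B)
        (.of_forall fun a => hB _)
      simpa using this
    have habs : ∀ (G : X → ℝ), (∀ a, |G a| ≤ 1) → |∫ a, G a ∂μ| ≤ 1 := fun G hG => by
      have := norm_integral_le_of_norm_le_const (μ := μ) (f := G) (C := 1) (.of_forall hG)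
      simpa using this
    have hgd : ∀ r k y, |g r - g (Function.update r k y)| ≤ 1 := fun r k y => by
      rw [hg, ← integral_sub (hFr _) (hFr _)]
      refine habs _ fun a => ?_
      have := hd (Fin.cons a r) k.succ y
      rwa [← Fin.cons_update] at this
    have hFg : ∀ a r, |F (a, r) - g r| ≤ 1 := fun a r => by
      have : F (a, r) - g r = ∫ b, (F (a, r) - F (b, r)) ∂μ := by
        rw [integral_sub (integrable_const _) (hFr _)]; simp [hg]
      rw [this]
      refine habs _ fun b => ?_
      have := hd (Fin.cons a r) 0 b
      rwa [Fin.update_cons_zero] at this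
    have hFi : Integrable F (μ.prod ν) := hbdd _ _ B hFm (fun _ => hB _)
    set c := ∫ z, f z ∂(Measure.pi fun _ : Fin (m + 1) => μ) with hc
    have hcg : c = ∫ r, g r ∂ν := by
      rw [hc, tr (fun t => t), integral_prod_symm _ hFi]
    have hsq : ∀ {Y : Type _} [MeasurableSpace Y] (ρ : Measure Y) [IsProbabilityMeasure ρ]
        (h : Y → ℝ), Measurable h → (∀ y, |h y| ≤ B) → Integrable (fun y => (h y - c) ^ 2) ρ := by
      intro Y _ ρ _ h hh hK
      refine hbdd ρ _ ((B + |c|) ^ 2) (by fun_prop) fun y => ?_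
      rw [abs_pow]
      exact pow_le_pow_left₀ (abs_nonneg _) ((abs_sub _ _).trans (by linarith [hK y])) 2
    have hF2 : Integrable (fun p => (F p - c) ^ 2) (μ.prod ν) := hsq _ _ hFm (fun _ => hB _)
    rw [tr (fun t => (t - c) ^ 2), integral_prod_symm _ hF2]
    have hg2 : Integrable (fun r => (g r - c) ^ 2) ν := hsq _ _ hgm hgB
    calc ∫ r, ∫ a, (F (a, r) - c) ^ 2 ∂μ ∂ν ≤ ∫ r, (1 + (g r - c) ^ 2) ∂ν := by
          refine integral_mono hF2.integral_prod_right ((integrable_const _).add hg2) fun r => ?_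
          have h0 : Integrable (fun a => F (a, r) - g r) μ := (hFr r).sub (integrable_const _)
          -- Expand the square around `g r`; the cross term integrates to zero.
          calc ∫ a, (F (a, r) - c) ^ 2 ∂μ
              ≤ ∫ a, ((F (a, r) - g r) * (2 * (g r - c)) + (1 + (g r - c) ^ 2)) ∂μ := by
                refine integral_mono (hsq μ _ (by fun_prop) (fun _ => hB _))
                  ((h0.mul_const _).add (integrable_const _)) fun a => ?_
                have h1 := (sq_le_one_iff_abs_le_one _).2 (hFg a r)
                simp only
                nlinarith
            _ = 1 + (g r - c) ^ 2 := by
                rw [integral_add (h0.mul_const _) (integrable_const _), integral_mul_const,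
                  integral_sub (hFr r) (integrable_const _)]
                simp [hg]
      _ = 1 + ∫ r, (g r - c) ^ 2 ∂ν := by
          rw [integral_add (integrable_const _) hg2]; simp
      _ ≤ _ := by
          have := ih g hgm hgB hgd
          rw [← hcg] at this
          push_cast
          linarith

/-! ### Truncation and escape through a mesh. -/

/-- The truncated absolute value. -/
def truncAbs (s : ℝ) : ℝ := min |s| 1

lemma lipschitzWith_truncAbs : LipschitzWith 1 truncAbs :=
  lipschitzWith_one_norm.min_const 1

lemma truncAbs_nonneg (s : ℝ) : 0 ≤ truncAbs s := le_min (abs_nonneg _) zero_le_one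

lemma truncAbs_le_one (s : ℝ) : truncAbs s ≤ 1 := min_le_right _ _

/-- The mean of the truncated absolute value of a standard real Gaussian. -/
def truncAbsMean : ℝ := ∫ s, truncAbs s ∂(gaussianReal 0 1)

lemma integrable_truncAbs {Ω : Type*} [MeasurableSpace Ω] (μ : Measure Ω)
    [IsProbabilityMeasure μ] {f : Ω → ℝ} (hf : Measurable f) :
    Integrable (fun x => truncAbs (f x)) μ :=
  Integrable.of_bound (lipschitzWith_truncAbs.continuous.measurable.comp hf).aestronglyMeasurable 1
    (.of_forall fun s => by
      rw [Real.norm_eq_abs, abs_of_nonneg (truncAbs_nonneg _)]; exact truncAbs_le_one _)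

lemma truncAbsMean_pos : 0 < truncAbsMean := by
  rw [truncAbsMean, integral_pos_iff_support_of_nonneg truncAbs_nonneg
    (integrable_truncAbs _ measurable_id)]
  have hs : Function.support truncAbs = {0}ᶜ := by
    ext s
    simp only [Function.mem_support, Set.mem_compl_iff, Set.mem_singleton_iff, truncAbs]
    constructor
    · rintro h rfl; simp at h
    · intro h; exact (lt_min (abs_pos.2 h) one_pos).ne'
  have := nullSingletonClass_gaussianReal (μ := 0) (v := 1) one_ne_zero
  rw [hs, prob_compl_eq_one_sub (measurableSet_singleton _), measure_singleton]
  simp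

lemma truncAbsMean_le_one : truncAbsMean ≤ 1 := by
  have h := integral_mono (μ := gaussianReal 0 1) (integrable_truncAbs _ measurable_id)
    (integrable_const 1) truncAbs_le_one
  simpa [truncAbsMean] using h

section Escape

variable {E : Type*} [NormedAddCommGroup E] [NormedSpace ℝ E]
  [MeasurableSpace E] [BorelSpace E] [SecondCountableTopology E] [CompleteSpace E]
  {μ : Measure E} [IsGaussian μ]

lemma integral_truncAbs_dual (hμ : ∫ x, x ∂μ = 0) {L : StrongDual ℝ E} (hL : Var[L; μ] = 1) :
    ∫ x, truncAbs (L x) ∂μ = truncAbsMean := by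
  have h := IsGaussian.map_eq_gaussianReal (μ := μ) L
  rw [hL, IsGaussian.integral_dual, hμ, map_zero, Real.toNNReal_one] at h
  rw [truncAbsMean, ← h, integral_map (by fun_prop)
    lipschitzWith_truncAbs.continuous.aestronglyMeasurable]

/-- Let `Z` be the largest deficit of the sums below their common mean `m * c`, with `c =
truncAbsMean`. Contraction gives mean at most `m * c / 4`, whereas the bad event forces `Z ≥ 3 * m *
c / 4`. Truncation makes each sample change `Z` by at most `1`, so the variance is at most `m` and
Chebyshev finishes. -/
lemma measure_exists_sum_truncAbs_le {ι : Type*} [Finite ι] [Nonempty ι] (hμ : ∫ x, x ∂μ = 0)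
    {u : ι → StrongDual ℝ E} (hu : ∀ i, Var[u i; μ] = 1) {W : E → ℝ} (hW : Integrable W μ)
    (huW : ∀ i x, u i x ≤ W x) {m : ℕ} (hm0 : 0 < m)
    (hm : 64 * (∫ x, W x ∂μ) ^ 2 ≤ truncAbsMean ^ 2 * m) :
    (Measure.pi fun _ : Fin m => μ) {x | ∃ i, ∑ k, truncAbs (u i (x k)) ≤ m * truncAbsMean / 4} ≤
      ENNReal.ofReal (4 / (m * truncAbsMean ^ 2)) := by
  set P := Measure.pi fun _ : Fin m => μ
  set w := ∫ x, W x ∂μ with hw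
  have hc0 := truncAbsMean_pos
  have hc1 := truncAbsMean_le_one
  set c := truncAbsMean
  have hmR : (0 : ℝ) < m := by exact_mod_cast hm0
  have hφm : Measurable truncAbs := lipschitzWith_truncAbs.continuous.measurable
  set Z : (Fin m → E) → ℝ := fun x => ⨆ i, ∑ k, (c - truncAbs (u i (x k))) with hZ
  have hZm : Measurable Z := Measurable.iSup fun i => by fun_prop
  have hZB : ∀ x, |Z x| ≤ m := fun x => by
    obtain ⟨i, hi⟩ := exists_eq_ciSup_of_finite
      (f := fun i => ∑ k, (c - truncAbs (u i (x k))))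
    simp only [hZ, ← hi]
    refine (Finset.abs_sum_le_sum_abs _ _).trans ?_
    refine (Finset.sum_le_card_nsmul _ _ 1 fun k _ => ?_).trans (by simp)
    rw [abs_le]
    constructor <;> linarith [truncAbs_nonneg (u i (x k)), truncAbs_le_one (u i (x k))]
  have hle : ∀ x y : Fin m → E, ∀ k a, (x = Function.update y k a ∨ y = Function.update x k a) →
      Z x ≤ Z y + 1 := by
    intro x y k a hxy
    refine ciSup_le fun i => ?_
    have h1 := le_iSup_of_finite (fun i => ∑ k, (c - truncAbs (u i (y k)))) i
    refine le_trans ?_ (add_le_add_left h1 1)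
    rw [← Finset.sum_erase_add _ _ (Finset.mem_univ k), ← Finset.sum_erase_add (a := k) (f :=
      fun k => c - truncAbs (u i (y k))) _ (Finset.mem_univ k)]
    have h2 : ∑ j ∈ Finset.univ.erase k, (c - truncAbs (u i (x j))) =
        ∑ j ∈ Finset.univ.erase k, (c - truncAbs (u i (y j))) := by
      refine Finset.sum_congr rfl fun j hj => ?_
      have hjk := Finset.ne_of_mem_erase hj
      rcases hxy with h | h <;> simp [h, hjk]
    rw [h2]
    linarith [truncAbs_nonneg (u i (x k)), truncAbs_le_one (u i (y k))]
  have hvar := integral_sq_sub_integral_le (μ := μ) m Z hZm m hZB fun x k a => by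
    rw [abs_le]
    constructor <;> linarith [hle x _ k a (Or.inr rfl), hle _ x k a (Or.inl rfl)]
  have hmean : ∫ x, Z x ∂P ≤ 2 * √m * w := by
    have h := integral_iSup_sum_sub_lipschitz_le (μ := μ) hμ lipschitzWith_truncAbs u m 0
    simp only [integral_truncAbs_dual hμ (hu _), Pi.zero_apply, zero_add] at h
    refine h.trans ?_
    rw [hw, ← integral_const_mul]
    refine integral_mono (integrable_iSup
      (fun i => (IsGaussian.integrable_dual μ (u i)).const_mul _) fun i => by fun_prop) (hW.const_mul _) fun x => ciSup_le fun i => ?_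
    exact mul_le_mul_of_nonneg_left (huW i x) (by positivity)
  have hw2 : 2 * √m * w ≤ m * c / 4 := by
    have h1 : |8 * w| ≤ |c * √m| := by
      rw [← sq_le_sq, mul_pow, mul_pow, Real.sq_sqrt hmR.le]; linarith
    have h2 : 8 * w ≤ c * √m := by
      rw [abs_of_nonneg (by positivity : 0 ≤ c * √m)] at h1; exact (le_abs_self _).trans h1
    have h3 := Real.mul_self_sqrt hmR.le
    nlinarith [Real.sqrt_nonneg (m : ℝ)]
  set e := ∫ x, Z x ∂P
  have hint : Integrable (fun x => (Z x - e) ^ 2) P := by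
    refine Integrable.of_bound (by fun_prop) ((m + |e|) ^ 2) (.of_forall fun x => ?_)
    rw [norm_pow]
    exact pow_le_pow_left₀ (norm_nonneg _) ((abs_sub _ _).trans (by linarith [hZB x])) 2
  have hcheb := mul_meas_ge_le_integral_of_nonneg (μ := P) (.of_forall fun x => sq_nonneg (Z x - e))
    hint ((m * c / 2) ^ 2)
  have hsub : {x : Fin m → E | ∃ i, ∑ k, truncAbs (u i (x k)) ≤ m * c / 4} ⊆
      {x | (m * c / 2) ^ 2 ≤ (Z x - e) ^ 2} := by
    rintro x ⟨i, hi⟩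
    have h1 := le_iSup_of_finite (fun i => ∑ k, (c - truncAbs (u i (x k)))) i
    simp only [Finset.sum_sub_distrib, Finset.sum_const, Finset.card_univ, Fintype.card_fin,
      nsmul_eq_mul] at h1
    have h2 : m * c - m * c / 4 ≤ Z x := by
      simp only [hZ, Finset.sum_sub_distrib, Finset.sum_const, Finset.card_univ, Fintype.card_fin,
        nsmul_eq_mul]
      linarith
    have h3 : m * c / 2 ≤ Z x - e := by linarith
    exact pow_le_pow_left₀ (by positivity) h3 2
  refine (measure_mono hsub).trans ?_
  rw [← ofReal_measureReal]
  refine ENNReal.ofReal_le_ofReal ?_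
  rw [le_div_iff₀ (by positivity)]
  have h5 := hcheb.trans hvar
  have h6 : (m : ℝ) * (P.real {x | (m * c / 2) ^ 2 ≤ (Z x - e) ^ 2} * (m * c ^ 2)) ≤ m * 4 := by
    nlinarith
  exact le_of_mul_le_mul_left h6 hmR

/-- Escape through a mesh: a family of unit-variance functionals of a centred Gaussian vector whose
supremum has small mean has no member vanishing on all of `m` independent samples, with high
probability. -/
theorem measure_exists_forall_eq_zero_le {κ : Type*} [TopologicalSpace κ]
    [TopologicalSpace.SeparableSpace κ] (hμ : ∫ x, x ∂μ = 0) {u : κ → StrongDual ℝ E}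
    (huc : ∀ x, Continuous fun h => u h x) (hu : ∀ i, Var[u i; μ] = 1) {W : E → ℝ}
    (hW : Integrable W μ) (huW : ∀ i x, u i x ≤ W x) {m : ℕ} (hm0 : 0 < m)
    (hm : 64 * (∫ x, W x ∂μ) ^ 2 ≤ truncAbsMean ^ 2 * m) :
    (Measure.pi fun _ : Fin m => μ) {x | ∃ h, ∀ k, u h (x k) = 0} ≤
      ENNReal.ofReal (4 / (m * truncAbsMean ^ 2)) := by
  rcases isEmpty_or_nonempty κ with hκ | hκ
  · simp
  -- The finite-family bound does not depend on the family's size. A common zero makes the sum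
  -- vanish, strictly below the threshold, so by continuity some member of the dense sequence is
  -- below it too.
  set d := TopologicalSpace.denseSeq κ
  set B : ℕ → Set (Fin m → E) := fun N =>
    {x | ∃ i : Fin (N + 1), ∑ k, truncAbs (u (d i) (x k)) ≤ m * truncAbsMean / 4} with hB
  have hmono : Monotone B := by
    rintro N M hNM x ⟨i, hi⟩
    exact ⟨⟨i, by omega⟩, hi⟩
  have hsub : {x : Fin m → E | ∃ h, ∀ k, u h (x k) = 0} ⊆ ⋃ N, B N := by
    rintro x ⟨h, hx⟩
    have hcont : Continuous fun h => ∑ k, truncAbs (u h (x k)) :=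
      continuous_finsetSum _ fun k _ => lipschitzWith_truncAbs.continuous.comp (huc (x k))
    have hopen : IsOpen {h | ∑ k, truncAbs (u h (x k)) < m * truncAbsMean / 4} :=
      isOpen_lt hcont continuous_const
    have hne : {h | ∑ k, truncAbs (u h (x k)) < m * truncAbsMean / 4}.Nonempty := by
      refine ⟨h, ?_⟩
      have := truncAbsMean_pos
      simp only [Set.mem_ofPred_eq, hx, truncAbs, abs_zero, zero_le_one, min_eq_left,
        Finset.sum_const_zero]
      positivity
    obtain ⟨N, hN⟩ := (TopologicalSpace.denseRange_denseSeq κ).exists_mem_open hopen hne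
    exact Set.mem_iUnion.2 ⟨N, ⟨N, by omega⟩, hN.le⟩
  refine (measure_mono hsub).trans ?_
  rw [hmono.measure_iUnion]
  exact iSup_le fun N => measure_exists_sum_truncAbs_le hμ (fun i => hu _) hW (fun i => huW _)
    hm0 hm

end Escape

/-! ### Unitarity of the DFT and the uncertainty principle. -/

section DFT

variable {n : ℕ}

lemma dft_conjTranspose_mul_self (hn : n ≠ 0) : (dft n)ᴴ * dft n = 1 := by
  set ζ := Complex.exp (-(2 * (Real.pi : ℂ) * Complex.I) / (n : ℂ)) with hζ
  have hprim : IsPrimitiveRoot ζ n := by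
    have h := (Complex.isPrimitiveRoot_exp n hn).inv
    rwa [← Complex.exp_neg, ← neg_div] at h
  have hζ0 : ζ ≠ 0 := Complex.exp_ne_zero _
  have hnorm : ‖ζ‖ = 1 := hprim.norm'_eq_one hn
  have hconj : star ζ = ζ⁻¹ := by
    rw [Complex.inv_def, Complex.normSq_eq_norm_sq, hnorm]; simp
  have hs : ((√(n : ℝ) : ℝ) : ℂ) * ((√(n : ℝ) : ℝ) : ℂ) = n := by
    rw [← Complex.ofReal_mul, Real.mul_self_sqrt (Nat.cast_nonneg _)]; simp
  have hnC : (n : ℂ) ≠ 0 := Nat.cast_ne_zero.2 hn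
  ext j k
  have hterm : ∀ i : Fin n, (dft n)ᴴ j i * dft n i k =
      (ζ ^ (k : ℕ) / ζ ^ (j : ℕ)) ^ (i : ℕ) / n := by
    intro i
    simp only [conjTranspose_apply, dft, ← hζ, star_div₀, star_pow, hconj]
    rw [show star ((√(n : ℝ) : ℝ) : ℂ) = ((√(n : ℝ) : ℝ) : ℂ) from Complex.conj_ofReal _,
      div_mul_div_comm, hs, div_pow, ← pow_mul, ← pow_mul, inv_pow]
    rw [mul_comm (k : ℕ), mul_comm (j : ℕ), inv_mul_eq_div]
  rw [mul_apply, Finset.sum_congr rfl fun i _ => hterm i, ← Finset.sum_div,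
    Fin.sum_univ_eq_sum_range (fun i => (ζ ^ (k : ℕ) / ζ ^ (j : ℕ)) ^ i) n]
  rcases eq_or_ne j k with rfl | hjk
  · rw [div_self (pow_ne_zero _ hζ0)]
    simp [hnC]
  · have hne : ζ ^ (k : ℕ) / ζ ^ (j : ℕ) ≠ 1 := by
      rw [Ne, div_eq_one_iff_eq (pow_ne_zero _ hζ0)]
      intro h
      exact hjk (Fin.ext (hprim.pow_inj j.2 k.2 h.symm))
    rw [geom_sum_eq hne, div_pow, ← pow_mul, ← pow_mul, mul_comm (k : ℕ), mul_comm (j : ℕ),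
      pow_mul, pow_mul, hprim.pow_eq_one]
    simp [hjk]

lemma norm_dft (i j : Fin n) : ‖dft n i j‖ = (√n)⁻¹ := by
  have hn : n ≠ 0 := by rintro rfl; exact i.elim0
  have hprim := (Complex.isPrimitiveRoot_exp n hn).inv
  rw [← Complex.exp_neg, ← neg_div] at hprim
  rw [dft, norm_div, norm_pow, hprim.norm'_eq_one hn]
  simp [abs_of_nonneg]

lemma dft_inversion (h : Fin n → ℂ) : (dft n)ᴴ *ᵥ (dft n *ᵥ h) = h := by
  rcases Nat.eq_zero_or_pos n with rfl | hn
  · exact Subsingleton.elim _ _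
  · rw [mulVec_mulVec, dft_conjTranspose_mul_self hn.ne', one_mulVec]

lemma sum_norm_sq_dft (h : Fin n → ℂ) : ∑ i, ‖(dft n *ᵥ h) i‖ ^ 2 = ∑ i, ‖h i‖ ^ 2 := by
  have key : ∀ v : Fin n → ℂ, ((∑ i, ‖v i‖ ^ 2 : ℝ) : ℂ) = star v ⬝ᵥ v := by
    intro v
    simp only [dotProduct, Pi.star_apply]
    push_cast
    refine Finset.sum_congr rfl fun i _ => ?_
    rw [← Complex.conj_mul']
    rfl
  have : star (dft n *ᵥ h) ⬝ᵥ (dft n *ᵥ h) = star h ⬝ᵥ h := by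
    rw [star_mulVec, ← dotProduct_mulVec, dft_inversion]
  exact_mod_cast (key _).trans (this.trans (key _).symm)

lemma norm_mulVec_le {U : Matrix (Fin n) (Fin n) ℂ} {c : ℝ} (hU : ∀ i j, ‖U i j‖ ≤ c)
    (v : Fin n → ℂ) (i : Fin n) : ‖(U *ᵥ v) i‖ ≤ c * l1Norm v := by
  rw [mulVec, dotProduct, l1Norm, Finset.mul_sum]
  refine (norm_sum_le _ _).trans (Finset.sum_le_sum fun j _ => ?_)
  rw [norm_mul]
  exact mul_le_mul_of_nonneg_right (hU i j) (norm_nonneg _)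

lemma l1Norm_le_card_supp_mul (v : Fin n → ℂ) {b : ℝ} (hb : ∀ i, ‖v i‖ ≤ b) :
    l1Norm v ≤ (Finset.univ.filter fun i => v i ≠ 0).card * b := by
  rw [l1Norm, ← nsmul_eq_mul]
  rw [← Finset.sum_filter_of_ne (p := fun i => v i ≠ 0) (fun i _ h => by simpa using h)]
  exact Finset.sum_le_card_nsmul _ _ _ fun i _ => hb i

/-- The uncertainty principle for the discrete Fourier transform. -/
lemma le_card_supp_mul_card_supp_dft {x : Fin n → ℂ} (hx : x ≠ 0) :
    n ≤ (supp 1 x).card * (supp (dft n) x).card := by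
  obtain ⟨i₀, hi₀⟩ := Function.ne_iff.1 hx
  have : Nonempty (Fin n) := ⟨i₀⟩
  have hn : (0 : ℝ) < n := by exact_mod_cast i₀.pos
  obtain ⟨i, hi⟩ := Finite.exists_max (fun i => ‖x i‖)
  have hpos : 0 < ‖x i‖ := (norm_pos_iff.2 hi₀).trans_le (hi i₀)
  have hs := Real.sqrt_pos.2 hn
  have h1 : l1Norm x ≤ (supp 1 x).card * ‖x i‖ := by
    simpa [supp] using l1Norm_le_card_supp_mul x hi
  have h2 : l1Norm (dft n *ᵥ x) ≤ (supp (dft n) x).card * ((√n)⁻¹ * l1Norm x) :=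
    l1Norm_le_card_supp_mul _ (norm_mulVec_le (fun i j => (norm_dft i j).le) x)
  have h3 : ‖x i‖ ≤ (√n)⁻¹ * l1Norm (dft n *ᵥ x) := by
    have := norm_mulVec_le (U := (dft n)ᴴ) (c := (√n)⁻¹)
      (fun i j => by rw [conjTranspose_apply, norm_star, norm_dft]) (dft n *ᵥ x) i
    rwa [dft_inversion] at this
  -- Go from the sup norm to `ℓ₁` and back through `D` and its inverse; each passage contributes one
  -- factor `(√n)⁻¹` and one support size.
  have h4 : ‖x i‖ ≤ (√n)⁻¹ * ((supp (dft n) x).card * ((√n)⁻¹ * ((supp 1 x).card * ‖x i‖))) := by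
    refine h3.trans (mul_le_mul_of_nonneg_left (h2.trans ?_) (by positivity))
    gcongr
  have h5 : (√n)⁻¹ * ((supp (dft n) x).card * ((√n)⁻¹ * ((supp 1 x).card * ‖x i‖))) =
      ((supp 1 x).card * (supp (dft n) x).card : ℝ) / n * ‖x i‖ := by
    nth_rewrite 3 [← Real.mul_self_sqrt hn.le]
    field_simp
  rw [h5] at h4
  have h6 : 1 ≤ ((supp 1 x).card * (supp (dft n) x).card : ℝ) / n := by
    by_contra! h
    nlinarith
  rw [le_div_iff₀ hn, one_mul] at h6
  exact_mod_cast h6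

end DFT

/-! ### The descent cone. -/

section Descent

variable {n : ℕ}

/-- Off the support of `a` the increment is exactly `‖b i‖`; on it, the triangle inequality loses at
most `2 * ‖(b - a) i‖`, summed by Cauchy–Schwarz. -/
lemma l1Norm_sub_le (a b : Fin n → ℂ) :
    l1Norm (b - a) ≤ l1Norm b - l1Norm a +
      2 * (√(Finset.univ.filter fun i => a i ≠ 0).card * √(∑ i, ‖(b - a) i‖ ^ 2)) := by
  set S := Finset.univ.filter fun i => a i ≠ 0 with hS
  have hcs : ∑ i ∈ S, ‖(b - a) i‖ ≤ √S.card * √(∑ i, ‖(b - a) i‖ ^ 2) := by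
    rw [← Real.sqrt_mul (Nat.cast_nonneg _)]
    refine Real.le_sqrt_of_sq_le ((sq_sum_le_card_mul_sum_sq).trans ?_)
    exact mul_le_mul_of_nonneg_left (Finset.sum_le_sum_of_subset_of_nonneg (Finset.subset_univ _)
      fun _ _ _ => sq_nonneg _) (Nat.cast_nonneg _)
  have hpt : ∀ i, ‖(b - a) i‖ ≤ ‖b i‖ - ‖a i‖ + 2 * (if a i ≠ 0 then ‖(b - a) i‖ else 0) := by
    intro i
    simp only [Pi.sub_apply]
    split_ifs with h
    · have := norm_sub_norm_le (a i) (b i)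
      rw [norm_sub_rev] at this
      linarith
    · rw [not_not] at h
      simp [h]
  have hsum := Finset.sum_le_sum fun i (_ : i ∈ Finset.univ) => hpt i
  rw [Finset.sum_add_distrib, Finset.sum_sub_distrib, ← Finset.mul_sum,
    ← Finset.sum_filter] at hsum
  simp only [l1Norm]
  linarith

/-- The descent cone of the cost at `x` consists of vectors that are compressible in both bases. -/
lemma cost_sub_le_of_cost_le {x y : Fin n → ℂ} {lam : ℝ} (hlam : 0 ≤ lam)
    (hxy : cost 1 (dft n) lam y ≤ cost 1 (dft n) lam x) :
    l1Norm (y - x) + lam * l1Norm (dft n *ᵥ (y - x)) ≤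
      2 * (√(supp 1 x).card + lam * √(supp (dft n) x).card) * √(∑ i, ‖(y - x) i‖ ^ 2) := by
  have h1 := l1Norm_sub_le x y
  have h2 := l1Norm_sub_le (dft n *ᵥ x) (dft n *ᵥ y)
  rw [← mulVec_sub, sum_norm_sq_dft] at h2
  have h3 := mul_le_mul_of_nonneg_left h2 hlam
  simp only [cost, one_mulVec] at hxy
  simp only [supp, one_mulVec]
  linarith

end Descent

/-! ### Complex Gaussian vectors and their real functionals. -/

section ComplexGaussian

lemma measurable_complex_mk : Measurable fun p : ℝ × ℝ => (⟨p.1, p.2⟩ : ℂ) :=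
  Complex.measurableEquivRealProd.symm.measurable

lemma measurePreserving_complex_mk (v : ℝ≥0) :
    MeasurePreserving (fun p : ℝ × ℝ => (⟨p.1, p.2⟩ : ℂ))
      ((gaussianReal 0 (v / 2)).prod (gaussianReal 0 (v / 2))) (complexGaussian v) :=
  ⟨measurable_complex_mk, rfl⟩

lemma integral_complexGaussian (v : ℝ≥0) (f : ℂ → ℝ) :
    ∫ z, f z ∂complexGaussian v =
      ∫ p : ℝ × ℝ, f ⟨p.1, p.2⟩ ∂(gaussianReal 0 (v / 2)).prod (gaussianReal 0 (v / 2)) :=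
  ((measurePreserving_complex_mk v).integral_comp
    Complex.measurableEquivRealProd.symm.measurableEmbedding f).symm

lemma integrable_complexGaussian_iff (v : ℝ≥0) (f : ℂ → ℝ) :
    Integrable f (complexGaussian v) ↔
      Integrable (fun p : ℝ × ℝ => f ⟨p.1, p.2⟩)
        ((gaussianReal 0 (v / 2)).prod (gaussianReal 0 (v / 2))) :=
  ((measurePreserving_complex_mk v).integrable_comp_emb
    Complex.measurableEquivRealProd.symm.measurableEmbedding).symm

instance isGaussian_complexGaussian (v : ℝ≥0) : IsGaussian (complexGaussian v) := by
  have h : complexGaussian v = ((gaussianReal 0 (v / 2)).prod (gaussianReal 0 (v / 2))).map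
      (Complex.equivRealProdCLM.symm : ℝ × ℝ → ℂ) := rfl
  rw [h]
  infer_instance

/-- The law of a row of the measurement matrix, normalised so that real and imaginary parts of the
entries are standard Gaussians. -/
def rowLaw (n : ℕ) : Measure (Fin n → ℂ) := Measure.pi fun _ => complexGaussian 2

instance isGaussian_rowLaw (n : ℕ) : IsGaussian (rowLaw n) := by
  have h := iIndepFun.hasGaussianLaw (P := rowLaw n) (X := fun (i : Fin n) (ω : Fin n → ℂ) => ω i)
    (fun i => ⟨by
      rw [rowLaw, (measurePreserving_eval (fun _ : Fin n => complexGaussian 2) i).map_eq]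
      infer_instance⟩)
    (iIndepFun_pi (X := fun _ z => z) fun i => aemeasurable_id)
  have h2 := h.isGaussian_map
  rwa [Measure.map_id'] at h2

/-- The real linear functional `a ↦ Re ∑ aⱼ hⱼ`. -/
def reDot {n : ℕ} (h : Fin n → ℂ) : StrongDual ℝ (Fin n → ℂ) :=
  ∑ j, Complex.reCLM ∘L ((ContinuousLinearMap.mul ℝ ℂ).flip (h j)) ∘L
    ContinuousLinearMap.proj (R := ℝ) (φ := fun _ : Fin n => ℂ) j

lemma reDot_apply {n : ℕ} (h a : Fin n → ℂ) : reDot h a = ∑ j, (a j * h j).re := by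
  simp [reDot, mul_comm]

lemma integral_re_mul_complexGaussian (c : ℂ) : ∫ z, (z * c).re ∂complexGaussian 2 = 0 := by
  have h1 : Integrable (fun x : ℝ => x) (gaussianReal 0 (2 / 2)) :=
    (memLp_id_gaussianReal 1).integrable le_rfl
  rw [integral_complexGaussian]
  simp only [Complex.mul_re]
  rw [integral_sub ((h1.comp_fst _).mul_const _) ((h1.comp_snd _).mul_const _),
    integral_mul_const, integral_mul_const, integral_fun_fst (fun x => x),
    integral_fun_snd (fun x => x)]
  simp

lemma variance_re_mul_complexGaussian (c : ℂ) :
    Var[fun z => (z * c).re; complexGaussian 2] = ‖c‖ ^ 2 := by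
  have h1 : MemLp (fun x : ℝ => x) 2 (gaussianReal 0 (2 / 2)) := memLp_id_gaussianReal 2
  rw [complexGaussian, variance_map (by fun_prop) measurable_complex_mk.aemeasurable]
  have e : ((fun z : ℂ => (z * c).re) ∘ fun p : ℝ × ℝ => (⟨p.1, p.2⟩ : ℂ)) =
      fun p => (fun x => c.re * x) p.1 + (fun x => (-c.im) * x) p.2 := by
    ext p; simp [Complex.mul_re]; ring
  rw [e, variance_add_prod (h1.const_mul _) (h1.const_mul _), variance_const_mul,
    variance_const_mul]
  simp only [variance_fun_id_gaussianReal]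
  rw [← Complex.normSq_eq_norm_sq, Complex.normSq_apply]
  simp
  ring

lemma variance_reDot {n : ℕ} (h : Fin n → ℂ) : Var[reDot h; rowLaw n] = ∑ j, ‖h j‖ ^ 2 := by
  have e : (reDot h : (Fin n → ℂ) → ℝ) = ∑ j, fun a : Fin n → ℂ => (a j * h j).re := by
    ext a; simp [reDot_apply]
  rw [e, rowLaw, variance_sum_pi (X := fun j z => (z * h j).re) fun j => ?_]
  · exact Finset.sum_congr rfl fun j _ => variance_re_mul_complexGaussian _
  · exact IsGaussian.memLp_dual (complexGaussian 2)
      (Complex.reCLM ∘L ((ContinuousLinearMap.mul ℝ ℂ).flip (h j))) 2 (by simp)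

lemma integral_id_rowLaw (n : ℕ) : ∫ x, x ∂rowLaw n = 0 := by
  have key : ∀ h : Fin n → ℂ, reDot h (∫ x, x ∂rowLaw n) = 0 := by
    intro h
    rw [← IsGaussian.integral_dual]
    simp only [reDot_apply]
    have hi : ∀ j, ∫ x : Fin n → ℂ, (x j * h j).re ∂rowLaw n = 0 := fun j => by
      have := integral_comp_eval (μ := fun _ : Fin n => complexGaussian 2) (i := j)
        (f := fun z => (z * h j).re) (by fun_prop)
      rw [rowLaw, this, integral_re_mul_complexGaussian]
    rw [integral_finsetSum _ fun j _ => ?_, Finset.sum_eq_zero fun j _ => hi j]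
    exact IsGaussian.integrable_dual (rowLaw n) (Complex.reCLM ∘L
      ((ContinuousLinearMap.mul ℝ ℂ).flip (h j)) ∘L
        ContinuousLinearMap.proj (R := ℝ) (φ := fun _ : Fin n => ℂ) j)
  ext j
  have h1 := key (Pi.single j 1)
  have h2 := key (Pi.single j Complex.I)
  simp only [reDot_apply] at h1 h2
  rw [Finset.sum_eq_single j (fun i _ hi => by simp [hi]) (by simp)] at h1 h2
  simp at h1 h2
  exact Complex.ext (by simpa using h1) (by simpa using h2)

end ComplexGaussian

/-! ### Exponential moments of the clipped-off part. -/

section Residual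

/-- What remains of `s` after clipping it to `[-t, t]`. -/
def residual (t s : ℝ) : ℝ := s - max (-t) (min s t)

@[fun_prop]
lemma measurable_residual (t : ℝ) : Measurable (residual t) := by
  unfold residual; fun_prop

lemma abs_sub_residual_le {t : ℝ} (ht : 0 ≤ t) (s : ℝ) : |s - residual t s| ≤ t := by
  rw [residual, sub_sub_cancel, abs_le]
  exact ⟨le_max_left _ _, max_le (by linarith) (min_le_right _ _)⟩

lemma residual_neg {t : ℝ} (ht : 0 ≤ t) (s : ℝ) : residual t (-s) = -residual t s := by
  unfold residual
  rcases le_total s (-t) with h1 | h1 <;> rcases le_total s t with h2 | h2 <;>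
    simp [max_def, min_def] <;> split_ifs <;> linarith

lemma abs_residual_cases {t : ℝ} (ht : 0 ≤ t) (s : ℝ) :
    residual t s = 0 ∨ (t ≤ |s| ∧ |residual t s| = |s| - t) := by
  unfold residual
  rcases le_total s (-t) with h1 | h1
  · right
    rw [min_eq_left (by linarith), max_eq_left h1, abs_of_nonpos (by linarith : s ≤ 0),
      abs_of_nonpos (by linarith : s - -t ≤ 0)]
    constructor <;> linarith
  · rcases le_total s t with h2 | h2
    · left; rw [min_eq_left h2, max_eq_right h1, sub_self]
    · right
      rw [min_eq_right h2, max_eq_right (by linarith), abs_of_nonneg (by linarith : 0 ≤ s),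
        abs_of_nonneg (by linarith : 0 ≤ s - t)]
      exact ⟨h2, rfl⟩

lemma abs_residual_le {t : ℝ} (ht : 0 ≤ t) (s : ℝ) : |residual t s| ≤ |s| := by
  rcases abs_residual_cases ht s with h | h
  · rw [h, abs_zero]; exact abs_nonneg _
  · linarith [h.2]

lemma exp_abs_le (s : ℝ) : Real.exp |s| ≤ Real.exp s + Real.exp (-s) := by
  rcases abs_cases s with h | h <;> rw [h.1] <;> linarith [Real.exp_pos s, Real.exp_pos (-s)]

/-- With `r = |residual t s|` nonzero, `r² exp r ≤ 2 exp (2r) ≤ 2 exp (t r)` and `t r = t|s| - t²`.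
The right side has an explicit Gaussian integral. -/
lemma residual_sq_mul_exp_le {t : ℝ} (ht : 2 ≤ t) (s : ℝ) :
    residual t s ^ 2 * Real.exp |residual t s| ≤
      2 * Real.exp (-t ^ 2) * (Real.exp (t * s) + Real.exp (-t * s)) := by
  rcases abs_residual_cases (by linarith : 0 ≤ t) s with h | ⟨h1, h2⟩
  · rw [h]; simp; positivity
  · set r := |residual t s|
    have hr : 0 ≤ r := abs_nonneg _
    have h3 : residual t s ^ 2 ≤ 2 * Real.exp r := by
      rw [← sq_abs]
      have := Real.quadratic_le_exp_of_nonneg hr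
      change r ^ 2 ≤ _
      linarith
    have h4 := exp_abs_le (t * s)
    rw [abs_mul, abs_of_nonneg (by linarith : 0 ≤ t)] at h4
    calc residual t s ^ 2 * Real.exp r ≤ 2 * Real.exp r * Real.exp r := by gcongr
      _ = 2 * Real.exp (2 * r) := by rw [mul_assoc, ← Real.exp_add]; ring_nf
      _ ≤ 2 * Real.exp (-t ^ 2 + t * |s|) := by
          gcongr
          nlinarith
      _ = 2 * Real.exp (-t ^ 2) * Real.exp (t * |s|) := by rw [Real.exp_add]; ring
      _ ≤ _ := by
          rw [neg_mul]
          gcongr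

lemma exp_le_one_add_add_sq_mul_exp (z : ℝ) :
    Real.exp z ≤ 1 + z + z ^ 2 * Real.exp |z| := by
  have h := Complex.norm_exp_sub_sum_le_norm_mul_exp (z : ℂ) 2
  simp only [Finset.sum_range_succ, Finset.sum_range_zero, pow_zero, Nat.factorial, Nat.cast_one,
    div_one, zero_add, pow_one, Complex.norm_real, Real.norm_eq_abs, sq_abs] at h
  norm_num at h
  rw [← Complex.ofReal_exp, ← Complex.ofReal_one, ← Complex.ofReal_add, ← Complex.ofReal_sub,
    Complex.norm_real] at h
  linarith [(le_abs_self _).trans h]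

lemma integrable_exp_mul_residual {t : ℝ} (ht : 0 ≤ t) (a : ℝ) :
    Integrable (fun s => Real.exp (a * residual t s)) (gaussianReal 0 1) := by
  refine Integrable.mono' ((integrable_exp_mul_gaussianReal a).add
    (integrable_exp_mul_gaussianReal (-a))) (by fun_prop) (.of_forall fun s => ?_)
  rw [Real.norm_eq_abs, abs_of_pos (Real.exp_pos _)]
  have h := exp_abs_le (a * s)
  simp only [Pi.add_apply, neg_mul]
  refine le_trans (Real.exp_le_exp.2 ?_) h
  refine (le_abs_self _).trans ?_
  rw [abs_mul, abs_mul]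
  exact mul_le_mul_of_nonneg_left (abs_residual_le ht s) (abs_nonneg _)

/-- The residual is odd, so the linear term of the exponential vanishes in mean. The quadratic
remainder integrates to a multiple of `exp(-t²) exp(t²/2) = exp(-t²/2)`, which acts as the variance.
-/
lemma integral_exp_mul_residual_le {t : ℝ} (ht : 2 ≤ t) {a : ℝ} (ha : |a| ≤ 1) :
    ∫ s, Real.exp (a * residual t s) ∂gaussianReal 0 1 ≤
      Real.exp (4 * Real.exp (-(t ^ 2 / 2)) * a ^ 2) := by
  have ht0 : 0 ≤ t := by linarith
  have hid : Integrable (fun x : ℝ => x) (gaussianReal 0 1) :=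
    (memLp_id_gaussianReal 1).integrable le_rfl
  have hr : Integrable (residual t) (gaussianReal 0 1) :=
    Integrable.mono' hid.abs (by fun_prop) (.of_forall fun s => abs_residual_le ht0 s)
  have hr0 : ∫ s, residual t s ∂gaussianReal 0 1 = 0 := by
    have h1 : ∫ s, residual t (-s) ∂gaussianReal 0 1 = ∫ s, residual t s ∂gaussianReal 0 1 := by
      have := integral_map (μ := gaussianReal 0 1) (φ := fun x => -x) (f := residual t)
        (by fun_prop) (by fun_prop)
      rw [gaussianReal_map_neg, neg_zero] at this
      exact this.symm
    simp only [residual_neg ht0, integral_neg] at h1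
    linarith
  have he : ∀ b : ℝ, ∫ s, Real.exp (b * s) ∂gaussianReal 0 1 = Real.exp (b ^ 2 / 2) := fun b => by
    have := congrFun (mgf_id_gaussianReal (μ := 0) (v := 1)) b
    simpa [mgf] using this
  have I1 := (integrable_exp_mul_gaussianReal (μ := 0) (v := 1) t).add
    (integrable_exp_mul_gaussianReal (μ := 0) (v := 1) (-t))
  have I2 : Integrable (fun s => a ^ 2 * (2 * Real.exp (-t ^ 2) *
      (Real.exp (t * s) + Real.exp (-t * s)))) (gaussianReal 0 1) := (I1.const_mul _).const_mul _
  have hpt : ∀ s, Real.exp (a * residual t s) ≤ (1 + a * residual t s) +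
      a ^ 2 * (2 * Real.exp (-t ^ 2) * (Real.exp (t * s) + Real.exp (-t * s))) := by
    intro s
    refine (exp_le_one_add_add_sq_mul_exp _).trans (add_le_add_right ?_ _)
    rw [mul_pow, mul_assoc]
    refine mul_le_mul_of_nonneg_left (le_trans ?_ (residual_sq_mul_exp_le ht s)) (sq_nonneg _)
    refine mul_le_mul_of_nonneg_left (Real.exp_le_exp.2 ?_) (sq_nonneg _)
    rw [abs_mul]
    exact mul_le_of_le_one_left (abs_nonneg _) ha
  have I3 : Integrable (fun s => 1 + a * residual t s) (gaussianReal 0 1) :=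
    (integrable_const _).add (hr.const_mul _)
  have h := integral_mono (integrable_exp_mul_residual ht0 a) (I3.add I2) hpt
  simp only [Pi.add_apply] at h
  rw [integral_add I3 I2, integral_add (integrable_const _) (hr.const_mul _), integral_const_mul,
    hr0, integral_const_mul, integral_const_mul,
    integral_add (integrable_exp_mul_gaussianReal t) (integrable_exp_mul_gaussianReal (-t)),
    he, he] at h
  refine h.trans ?_
  have h3 : Real.exp (-t ^ 2) * Real.exp (t ^ 2 / 2) = Real.exp (-(t ^ 2 / 2)) := by
    rw [← Real.exp_add]; ring_nf
  have h4 := Real.add_one_le_exp (4 * Real.exp (-(t ^ 2 / 2)) * a ^ 2)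
  rw [← h3] at h4 ⊢
  simp only [integral_const, probReal_univ, one_smul, mul_zero, add_zero, neg_sq]
  linarith

/-- Coordinatewise residual of a complex number. -/
def complexResidual (t : ℝ) (z : ℂ) : ℂ := ⟨residual t z.re, residual t z.im⟩

@[fun_prop]
lemma measurable_complexResidual (t : ℝ) : Measurable (complexResidual t) :=
  measurable_complex_mk.comp
    (((measurable_residual t).comp Complex.measurable_re).prodMk
      ((measurable_residual t).comp Complex.measurable_im))

lemma norm_sub_complexResidual_le {t : ℝ} (ht : 0 ≤ t) (z : ℂ) :
    ‖z - complexResidual t z‖ ≤ 2 * t := by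
  refine (Complex.norm_le_abs_re_add_abs_im _).trans ?_
  have h1 := abs_sub_residual_le ht z.re
  have h2 := abs_sub_residual_le ht z.im
  simp only [complexResidual, Complex.sub_re, Complex.sub_im]
  linarith

lemma exp_re_mul_complexResidual (t : ℝ) (c : ℂ) (p : ℝ × ℝ) :
    Real.exp (c * complexResidual t ⟨p.1, p.2⟩).re =
      Real.exp (c.re * residual t p.1) * Real.exp (-c.im * residual t p.2) := by
  rw [← Real.exp_add]
  simp [complexResidual, Complex.mul_re, sub_eq_add_neg]

lemma integrable_exp_re_mul_complexResidual {t : ℝ} (ht : 0 ≤ t) (c : ℂ) :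
    Integrable (fun z => Real.exp (c * complexResidual t z).re) (complexGaussian 2) := by
  rw [integrable_complexGaussian_iff]
  simp only [exp_re_mul_complexResidual]
  rw [div_self two_ne_zero]
  exact (integrable_exp_mul_residual ht _).mul_prod (integrable_exp_mul_residual ht _)

lemma integral_exp_re_mul_complexResidual_le {t : ℝ} (ht : 2 ≤ t) {c : ℂ} (hc : ‖c‖ ≤ 1) :
    ∫ z, Real.exp (c * complexResidual t z).re ∂complexGaussian 2 ≤
      Real.exp (4 * Real.exp (-(t ^ 2 / 2)) * ‖c‖ ^ 2) := by
  rw [integral_complexGaussian]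
  simp only [exp_re_mul_complexResidual]
  rw [div_self two_ne_zero, integral_prod_mul (fun s => Real.exp (c.re * residual t s))
    (fun s => Real.exp (-c.im * residual t s)), ← Complex.normSq_eq_norm_sq, Complex.normSq_apply,
    show 4 * Real.exp (-(t ^ 2 / 2)) * (c.re * c.re + c.im * c.im) =
      4 * Real.exp (-(t ^ 2 / 2)) * c.re ^ 2 + 4 * Real.exp (-(t ^ 2 / 2)) * (-c.im) ^ 2 by ring,
    Real.exp_add]
  exact mul_le_mul (integral_exp_mul_residual_le ht ((Complex.abs_re_le_norm c).trans hc))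
    (integral_exp_mul_residual_le ht (by rw [abs_neg]; exact (Complex.abs_im_le_norm c).trans hc))
    (integral_nonneg fun s => (Real.exp_pos _).le) (Real.exp_pos _).le

lemma exp_re_sum_mul_complexResidual {n : ℕ} (t : ℝ) (c g : Fin n → ℂ) :
    Real.exp (∑ j, c j * complexResidual t (g j)).re =
      ∏ j, Real.exp (c j * complexResidual t (g j)).re := by
  rw [Complex.re_sum, Real.exp_sum]

lemma integrable_exp_re_sum_mul_complexResidual {n : ℕ} {t : ℝ} (ht : 0 ≤ t) (c : Fin n → ℂ) :
    Integrable (fun g => Real.exp (∑ j, c j * complexResidual t (g j)).re) (rowLaw n) := by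
  simp only [exp_re_sum_mul_complexResidual]
  exact Integrable.fintype_prod (f := fun j z => Real.exp (c j * complexResidual t z).re)
    fun j => integrable_exp_re_mul_complexResidual ht _

lemma integral_exp_re_sum_mul_complexResidual_le {n : ℕ} {t : ℝ} (ht : 2 ≤ t) {c : Fin n → ℂ}
    (hc : ∀ j, ‖c j‖ ≤ 1) :
    ∫ g, Real.exp (∑ j, c j * complexResidual t (g j)).re ∂rowLaw n ≤
      Real.exp (4 * Real.exp (-(t ^ 2 / 2)) * ∑ j, ‖c j‖ ^ 2) := by
  simp only [exp_re_sum_mul_complexResidual]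
  rw [rowLaw, integral_fintype_prod_eq_prod
    (f := fun j z => Real.exp (c j * complexResidual t z).re), Finset.mul_sum, Real.exp_sum]
  exact Finset.prod_le_prod (fun j _ => integral_nonneg fun z => (Real.exp_pos _).le)
    fun j _ => integral_exp_re_mul_complexResidual_le ht (hc j)

end Residual

/-! ### Mean width in two bases. -/

section Width

variable {n : ℕ}

/-- The Fourier transform of the residual of a Gaussian vector has small sup norm in mean. -/
lemma exists_integrable_bound_dft_complexResidual (hn : 0 < n) {t θ : ℝ} (ht : 2 ≤ t) (hθ : 0 < θ)
    (hθn : θ ≤ √n) :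
    ∃ V : (Fin n → ℂ) → ℝ, Integrable V (rowLaw n) ∧
      ∫ g, V g ∂rowLaw n ≤ (Real.log (4 * n) + 4 * Real.exp (-(t ^ 2 / 2)) * θ ^ 2) / θ ∧
      ∀ g k, ‖∑ j, star (dft n k j) * complexResidual t (g j)‖ ≤ 2 * V g := by
  have hnR : (0 : ℝ) < n := by exact_mod_cast hn
  have hs : 0 < √(n : ℝ) := Real.sqrt_pos.2 hnR
  set K := 4 * Real.exp (-(t ^ 2 / 2)) * θ ^ 2 with hK
  set b := Real.log (4 * n) + K with hb
  -- The four powers of `I` turn one-sided exponential bounds into bounds on `±Re` and `±Im`; `θ ≤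
  -- √n` keeps every coefficient within norm `1`.
  set c : Fin n → Fin 4 → Fin n → ℂ := fun k i j => θ * Complex.I ^ (i : ℕ) * star (dft n k j)
    with hc
  have hcn : ∀ k i j, ‖c k i j‖ = θ * (√n)⁻¹ := fun k i j => by
    simp only [hc, norm_mul, norm_pow, Complex.norm_I, one_pow, norm_star, norm_dft,
      Complex.norm_real, Real.norm_eq_abs, abs_of_pos hθ, mul_one]
  have hc1 : ∀ k i j, ‖c k i j‖ ≤ 1 := fun k i j => by
    rw [hcn, ← div_eq_mul_inv, div_le_one hs]; exact hθn
  have hc2 : ∀ k i, ∑ j, ‖c k i j‖ ^ 2 = θ ^ 2 := fun k i => by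
    simp only [hcn, Finset.sum_const, Finset.card_univ, Fintype.card_fin, nsmul_eq_mul, mul_pow,
      inv_pow, Real.sq_sqrt hnR.le]
    field_simp
  set Y : (Fin n → ℂ) → Fin n → Fin 4 → ℝ := fun g k i =>
    (∑ j, c k i j * complexResidual t (g j)).re with hY
  have hYi : ∀ k i, Integrable (fun g => Real.exp (Y g k i)) (rowLaw n) := fun k i =>
    integrable_exp_re_sum_mul_complexResidual (by linarith) (c k i)
  have hYb : ∀ k i, ∫ g, Real.exp (Y g k i) ∂rowLaw n ≤ Real.exp K := fun k i => by
    have h := integral_exp_re_sum_mul_complexResidual_le ht (hc1 k i)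
    rwa [hc2] at h
  have hSi : Integrable (fun g => ∑ k, ∑ i, Real.exp (Y g k i)) (rowLaw n) :=
    integrable_finsetSum _ fun k _ => integrable_finsetSum _ fun i _ => hYi k i
  -- The tangent inequality `y ≤ b - 1 + exp (y - b)`, with the exponential summed over all `4 * n`
  -- variables, bounds them simultaneously. The choice of `b` makes the exponential term have mean
  -- at most `1`.
  refine ⟨fun g => (b - 1 + (∑ k, ∑ i, Real.exp (Y g k i)) * Real.exp (-b)) / θ, ?_, ?_, ?_⟩
  · exact ((integrable_const _).add (hSi.mul_const _)).div_const _
  · rw [integral_div, integral_add (integrable_const _) (hSi.mul_const _), integral_mul_const,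
      integral_finsetSum _ fun k _ => integrable_finsetSum _ fun i _ => hYi k i]
    simp only [integral_const, probReal_univ, one_smul]
    have h1 : ∑ k, ∫ g, ∑ i, Real.exp (Y g k i) ∂rowLaw n ≤ 4 * n * Real.exp K := by
      refine (Finset.sum_le_card_nsmul _ _ (4 * Real.exp K) fun k _ => ?_).trans
        (by simp only [Finset.card_univ, Fintype.card_fin, nsmul_eq_mul]; linarith)
      rw [integral_finsetSum _ fun i _ => hYi k i]
      refine (Finset.sum_le_card_nsmul _ _ _ fun i _ => hYb k i).trans (by simp)
    have h2 : 4 * n * Real.exp K * Real.exp (-b) = 1 := by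
      rw [hb, neg_add, Real.exp_add, Real.exp_neg, Real.exp_neg, Real.exp_log (by positivity)]
      field_simp
    gcongr
    have h3 := mul_le_mul_of_nonneg_right h1 (Real.exp_pos (-b)).le
    linarith
  · intro g k
    set V := (b - 1 + (∑ k, ∑ i, Real.exp (Y g k i)) * Real.exp (-b)) / θ with hV
    set X := ∑ j, star (dft n k j) * complexResidual t (g j) with hX
    have hle : ∀ i : Fin 4, (Complex.I ^ (i : ℕ) * X).re ≤ V := by
      intro i
      rw [hV, le_div_iff₀ hθ]
      have e : (Complex.I ^ (i : ℕ) * X).re * θ = Y g k i := by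
        simp only [hY, hc, hX]
        rw [mul_comm, ← Complex.re_ofReal_mul, Finset.mul_sum, Finset.mul_sum]
        congr 1
        exact Finset.sum_congr rfl fun j _ => by ring
      rw [e]
      have h1 : Real.exp (Y g k i) ≤ ∑ k, ∑ i, Real.exp (Y g k i) :=
        (Finset.single_le_sum (f := fun i => Real.exp (Y g k i))
          (fun i _ => (Real.exp_pos _).le) (Finset.mem_univ i)).trans
        (Finset.single_le_sum (f := fun k => ∑ i, Real.exp (Y g k i))
          (fun k _ => Finset.sum_nonneg fun i _ => (Real.exp_pos _).le) (Finset.mem_univ k))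
      have h2 := mul_le_mul_of_nonneg_right h1 (Real.exp_pos (-b)).le
      rw [← Real.exp_add] at h2
      have h3 := Real.add_one_le_exp (Y g k i + -b)
      linarith
    have h0 := hle 0
    have h1 := hle 1
    have h2 := hle 2
    have h3 := hle 3
    simp only [Fin.val_zero, Fin.val_one, Fin.val_two, show ((3 : Fin 4) : ℕ) = 3 from rfl,
      Complex.I_pow_three, pow_zero, one_mul, pow_one, Complex.I_sq, neg_mul, Complex.neg_re,
      Complex.I_mul_re, neg_neg] at h0 h1 h2 h3
    refine (Complex.norm_le_abs_re_add_abs_im X).trans ?_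
    have h4 : |X.re| ≤ V := abs_le.2 ⟨by linarith, h0⟩
    have h5 : |X.im| ≤ V := abs_le.2 ⟨by linarith, h3⟩
    linarith

/-- Fourier inversion moves the pairing to the Fourier side, where the `ℓ₁` norm of the transform of
`h` is controlled. -/
lemma sum_mul_eq_sum_dft (q h : Fin n → ℂ) :
    ∑ j, q j * h j = ∑ k, (∑ j, star (dft n k j) * q j) * (dft n *ᵥ h) k := by
  conv_lhs => rw [← dft_inversion h]
  simp only [mulVec, dotProduct, conjTranspose_apply, Finset.mul_sum, Finset.sum_mul]
  rw [Finset.sum_comm]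
  refine Finset.sum_congr rfl fun k _ => ?_
  rw [Finset.sum_comm]
  exact Finset.sum_congr rfl fun j _ => Finset.sum_congr rfl fun i _ => by ring

/-- A linear functional of a Gaussian vector, bounded by means of the `ℓ₁` norms of its coefficient
vector in the standard and the Fourier basis. -/
lemma reDot_le {t V : ℝ} (ht : 0 ≤ t) {g h : Fin n → ℂ}
    (hV : ∀ k, ‖∑ j, star (dft n k j) * complexResidual t (g j)‖ ≤ V) :
    reDot h g ≤ 2 * t * l1Norm h + V * l1Norm (dft n *ᵥ h) := by
  have e : reDot h g = (∑ j, (g j - complexResidual t (g j)) * h j).re +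
      (∑ j, complexResidual t (g j) * h j).re := by
    rw [← Complex.add_re, ← Finset.sum_add_distrib, reDot_apply, Complex.re_sum]
    exact Finset.sum_congr rfl fun j _ => by ring_nf
  have bound : ∀ (p d : Fin n → ℂ) (c : ℝ), (∀ j, ‖p j‖ ≤ c) → (∑ j, p j * d j).re ≤
      c * l1Norm d := by
    intro p d c hp
    refine (Complex.re_le_norm _).trans ((norm_sum_le _ _).trans ?_)
    rw [l1Norm, Finset.mul_sum]
    refine Finset.sum_le_sum fun j _ => ?_
    rw [norm_mul]
    exact mul_le_mul_of_nonneg_right (hp j) (norm_nonneg _)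
  rw [e, sum_mul_eq_sum_dft (fun j => complexResidual t (g j))]
  exact add_le_add (bound _ _ _ fun j => norm_sub_complexResidual_le ht (g j)) (bound _ _ _ hV)

lemma l1Norm_nonneg (v : Fin n → ℂ) : 0 ≤ l1Norm v := Finset.sum_nonneg fun _ _ => norm_nonneg _

/-- Mean width bound for the vectors that are compressible in the standard and in the Fourier
basis. -/
lemma exists_integrable_bound_reDot (hn : 0 < n) (hlog : 2 ≤ Real.log (Real.log n))
    (hpow : Real.log n ^ 2 ≤ √n) {lam R : ℝ} (hlam : (Real.log n)⁻¹ ≤ lam) :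
    ∃ W : (Fin n → ℂ) → ℝ, Integrable W (rowLaw n) ∧
      (∫ g, W g ∂rowLaw n) ^ 2 ≤ 288 * R ^ 2 * Real.log (Real.log n) ∧
      ∀ h, l1Norm h + lam * l1Norm (dft n *ᵥ h) ≤ R → ∀ g, reDot h g ≤ W g := by
  set L := Real.log n with hL
  set l := Real.log L with hl
  have hL0 : 0 ≤ L := Real.log_natCast_nonneg n
  have hL1 : 1 ≤ L := by
    by_contra! h
    have := Real.log_nonpos hL0 h.le
    linarith
  have hLpos : 0 < L := by linarith
  have hlampos : 0 < lam := (inv_pos.2 hLpos).trans_le hlam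
  -- Chosen so that `exp(-t²/2) = L⁻⁴`, which exactly cancels `θ²` for the choice `θ = L²` below.
  set t := √(8 * l) with htdef
  have ht2 : t ^ 2 = 8 * l := Real.sq_sqrt (by linarith)
  have ht4 : 4 ≤ t := Real.le_sqrt_of_sq_le (by linarith)
  obtain ⟨V, hVi, hVint, hVle⟩ := exists_integrable_bound_dft_complexResidual hn
    (by linarith : 2 ≤ t) (by positivity : 0 < L ^ 2) hpow
  have hexp : Real.exp (-(t ^ 2 / 2)) * (L ^ 2) ^ 2 = 1 := by
    rw [ht2, show 8 * l / 2 = ((4 : ℕ) : ℝ) * l by push_cast; ring, Real.exp_neg, Real.exp_nat_mul,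
      hl, Real.exp_log hLpos]
    field_simp
  have hV7 : ∫ g, V g ∂rowLaw n ≤ 7 / L := by
    refine hVint.trans ?_
    rw [mul_assoc, hexp, Real.log_mul (by norm_num) (by positivity), ← hL,
      div_le_div_iff₀ (by positivity) hLpos]
    have h4 : Real.log 4 ≤ 2 := by
      rw [show (4 : ℝ) = 2 ^ 2 by norm_num, Real.log_pow]
      push_cast
      linarith [Real.log_two_lt_d9]
    nlinarith
  have hV0 : ∀ g, 0 ≤ V g := fun g => by
    have := (norm_nonneg _).trans (hVle g ⟨0, hn⟩)
    linarith
  refine ⟨fun g => R * (2 * t + 2 / lam * V g), ?_, ?_, ?_⟩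
  · exact ((integrable_const _).add (hVi.const_mul _)).const_mul _
  · have hnn : 0 ≤ ∫ g, V g ∂rowLaw n := integral_nonneg hV0
    rw [integral_const_mul, integral_add (integrable_const _) (hVi.const_mul _),
      integral_const, probReal_univ, one_smul, integral_const_mul]
    have h1 : 2 / lam * ∫ g, V g ∂rowLaw n ≤ 14 := by
      have h2 : 1 / lam ≤ L := by
        rw [one_div]; exact inv_le_of_inv_le₀ hLpos hlam
      calc 2 / lam * ∫ g, V g ∂rowLaw n = 2 * (1 / lam) * ∫ g, V g ∂rowLaw n := by ring
        _ ≤ 2 * L * (7 / L) := by gcongr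
        _ = 14 := by field_simp; norm_num
    rw [mul_pow]
    have h3 : (2 * t + 2 / lam * ∫ g, V g ∂rowLaw n) ^ 2 ≤ (6 * t) ^ 2 := by
      refine pow_le_pow_left₀ (by positivity) ?_ 2
      linarith
    rw [mul_pow, ht2] at h3
    calc _ ≤ R ^ 2 * (6 ^ 2 * (8 * l)) := mul_le_mul_of_nonneg_left h3 (sq_nonneg _)
      _ = _ := by ring
  · intro h hh g
    refine (reDot_le (by linarith) (hVle g)).trans ?_
    have h1 : l1Norm h ≤ R := by
      linarith [mul_nonneg hlampos.le (l1Norm_nonneg (dft n *ᵥ h))]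
    have h2 : l1Norm (dft n *ᵥ h) ≤ R / lam := by
      rw [le_div_iff₀ hlampos]
      linarith [l1Norm_nonneg h]
    calc 2 * t * l1Norm h + 2 * V g * l1Norm (dft n *ᵥ h) ≤ 2 * t * R + 2 * V g * (R / lam) := by
          have := hV0 g
          gcongr
      _ = _ := by ring

end Width

/-! ### From width to recovery. -/

section Recovery

variable {m n : ℕ}

lemma complexGaussian_map_mul (v : ℝ≥0) (c : ℝ≥0) :
    (complexGaussian v).map (fun z => (c : ℂ) * z) = complexGaussian (c ^ 2 * v) := by
  have h1 : (gaussianReal 0 (v / 2)).map (fun x => (c : ℝ) * x) =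
      gaussianReal 0 (c ^ 2 * v / 2) := by
    rw [gaussianReal_map_const_mul, mul_zero]
    congr 1
    ext
    simp
    ring
  have e : (fun z : ℂ => (c : ℂ) * z) ∘ (fun p : ℝ × ℝ => (⟨p.1, p.2⟩ : ℂ)) =
      (fun p : ℝ × ℝ => (⟨p.1, p.2⟩ : ℂ)) ∘
        Prod.map (fun x => (c : ℝ) * x) (fun x => (c : ℝ) * x) := by
    ext p
    exact Complex.ext (by simp) (by simp)
  rw [complexGaussian, Measure.map_map (by fun_prop) measurable_complex_mk, e,
    ← Measure.map_map measurable_complex_mk (by fun_prop),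
    ← Measure.map_prod_map _ _ (by fun_prop) (by fun_prop), h1]
  rfl

lemma gaussianMatrix_map_mul (v : ℝ≥0) (c : ℝ≥0) :
    (gaussianMatrix m n v).map (fun A i j => (c : ℂ) * A i j) = gaussianMatrix m n (c ^ 2 * v) := by
  have hrow : (Measure.pi fun _ : Fin n => complexGaussian v).map (fun a j => (c : ℂ) * a j) =
      Measure.pi fun _ : Fin n => complexGaussian (c ^ 2 * v) := by
    have : ∀ i : Fin n, IsProbabilityMeasure ((complexGaussian v).map fun z => (c : ℂ) * z) :=
      fun _ => Measure.isProbabilityMeasure_map (by fun_prop)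
    rw [Measure.pi_map_pi (f := fun _ z => (c : ℂ) * z) (fun _ => by fun_prop)]
    simp only [complexGaussian_map_mul]
  have hp : IsProbabilityMeasure ((Measure.pi fun _ : Fin n => complexGaussian v).map
      fun a j => (c : ℂ) * a j) := by
    rw [hrow]; infer_instance
  have hmeas : Measurable fun (a : Fin n → ℂ) j => (c : ℂ) * a j := by fun_prop
  rw [gaussianMatrix, Measure.pi_map_pi (f := fun _ (a : Fin n → ℂ) j => (c : ℂ) * a j)
    (fun _ => hmeas.aemeasurable)]
  simp only [hrow]
  rfl

lemma recovers_of_recovers_mul {U₁ U₂ : Matrix (Fin n) (Fin n) ℂ} {lam : ℝ} {c : ℂ}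
    {A : Fin m → Fin n → ℂ} {x : Fin n → ℂ}
    (h : Recovers U₁ U₂ lam (Matrix.of fun i j => c * A i j) x) :
    Recovers U₁ U₂ lam (Matrix.of A) x := by
  intro y hy
  refine h y ?_
  have e : (Matrix.of fun i j => c * A i j) = c • Matrix.of A := rfl
  rw [e, smul_mulVec, smul_mulVec, hy]

/-- The variance of the entries does not matter for the recovery probability. -/
lemma gaussianMatrix_not_recovers_le {U₁ U₂ : Matrix (Fin n) (Fin n) ℂ} {lam : ℝ}
    {x : Fin n → ℂ} {v w : ℝ≥0} (hv : 0 < v) :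
    gaussianMatrix m n v {A | ¬ Recovers U₁ U₂ lam (Matrix.of A) x} ≤
      gaussianMatrix m n w {A | ¬ Recovers U₁ U₂ lam (Matrix.of A) x} := by
  set c : ℝ≥0 := NNReal.sqrt (w / v)
  have hc : c ^ 2 * v = w := by
    rw [NNReal.sq_sqrt, div_mul_cancel₀ _ hv.ne']
  have hmap := gaussianMatrix_map_mul (m := m) (n := n) v c
  rw [hc] at hmap
  rw [← hmap]
  have hmeas : Measurable fun (A : Fin m → Fin n → ℂ) i j => (c : ℂ) * A i j := by fun_prop
  -- The outer-measure inequality for pushforwards points the right way, so the failure set need not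
  -- be shown measurable.
  refine le_trans (measure_mono ?_) (Measure.le_map_apply hmeas.aemeasurable _)
  intro A hA h
  exact hA (recovers_of_recovers_mul h)

lemma l1Norm_smul (c : ℝ) (v : Fin n → ℂ) : l1Norm ((c : ℂ) • v) = |c| * l1Norm v := by
  simp [l1Norm, Finset.mul_sum]

/-- A failing competitor gives a kernel vector in the descent cone; normalised to the unit sphere it
indexes a unit-variance functional that vanishes on every row, the event controlled by escape
through a mesh. -/
lemma measure_not_recovers_le (hn : 0 < n) (hlog : 2 ≤ Real.log (Real.log n))
    (hpow : Real.log n ^ 2 ≤ √n) {lam R : ℝ} (hlam0 : 0 ≤ lam) (hlam : (Real.log n)⁻¹ ≤ lam)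
    (x : Fin n → ℂ) (hR : 2 * (√(supp 1 x).card + lam * √(supp (dft n) x).card) ≤ R)
    (hm0 : 0 < m) (hm : 64 * (288 * R ^ 2 * Real.log (Real.log n)) ≤ truncAbsMean ^ 2 * m)
    {v : ℝ≥0} (hv : 0 < v) :
    gaussianMatrix m n v {A | ¬ Recovers 1 (dft n) lam (Matrix.of A) x} ≤
      ENNReal.ofReal (4 / (m * truncAbsMean ^ 2)) := by
  refine (gaussianMatrix_not_recovers_le (w := 2) hv).trans ?_
  obtain ⟨W, hWi, hW2, hWle⟩ := exists_integrable_bound_reDot (R := R) hn hlog hpow hlam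
  let κ := {h : Fin n → ℂ // ∑ i, ‖h i‖ ^ 2 = 1 ∧ l1Norm h + lam * l1Norm (dft n *ᵥ h) ≤ R}
  have hesc := measure_exists_forall_eq_zero_le (κ := κ) (μ := rowLaw n) (integral_id_rowLaw n)
    (u := fun h => reDot h.1)
    (fun a => by
      simp only [reDot_apply]
      exact continuous_finsetSum _ fun j _ => Complex.continuous_re.comp
        (continuous_const.mul ((continuous_apply j).comp continuous_subtype_val)))
    (fun h => by rw [variance_reDot, h.2.1]) hWi (fun h g => hWle h.1 h.2.2 g) hm0
    (by linarith)
  refine (measure_mono ?_).trans hesc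
  intro A hA
  simp only [Recovers, not_forall, not_lt, Set.mem_ofPred_eq] at hA
  obtain ⟨y, hAy, hyx, hcost⟩ := hA
  set h := y - x with hh
  have hcone := cost_sub_le_of_cost_le hlam0 hcost
  have hpos : 0 < ∑ i, ‖h i‖ ^ 2 := by
    obtain ⟨i, hi⟩ := Function.ne_iff.1 hyx
    refine Finset.sum_pos' (fun i _ => sq_nonneg _) ⟨i, Finset.mem_univ i, ?_⟩
    have : 0 < ‖h i‖ := norm_pos_iff.2 (sub_ne_zero.2 hi)
    positivity
  set s := √(∑ i, ‖h i‖ ^ 2) with hs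
  have hs0 : 0 < s := Real.sqrt_pos.2 hpos
  refine ⟨⟨((s⁻¹ : ℝ) : ℂ) • h, ?_, ?_⟩, fun k => ?_⟩
  · simp only [Pi.smul_apply, norm_smul, mul_pow, ← Finset.mul_sum, Complex.norm_real, norm_inv,
      Real.norm_eq_abs, abs_of_pos hs0]
    rw [inv_pow, hs, Real.sq_sqrt hpos.le, inv_mul_cancel₀ hpos.ne']
  · rw [mulVec_smul, l1Norm_smul, l1Norm_smul, abs_of_pos (inv_pos.2 hs0)]
    have h1 : l1Norm h + lam * l1Norm (dft n *ᵥ h) ≤ R * s :=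
      hcone.trans (mul_le_mul_of_nonneg_right hR hs0.le)
    calc s⁻¹ * l1Norm h + lam * (s⁻¹ * l1Norm (dft n *ᵥ h)) =
        s⁻¹ * (l1Norm h + lam * l1Norm (dft n *ᵥ h)) := by ring
      _ ≤ s⁻¹ * (R * s) := mul_le_mul_of_nonneg_left h1 (inv_pos.2 hs0).le
      _ = R := by field_simp
  · have hAh : ∑ j, A k j * h j = 0 := by
      have := congrFun (show (Matrix.of A) *ᵥ h = 0 by rw [hh, mulVec_sub, hAy, sub_self]) k
      simpa [mulVec, dotProduct] using this
    rw [reDot_apply, ← Complex.re_sum]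
    have : ∑ j, A k j * (((s⁻¹ : ℝ) : ℂ) • h) j = ((s⁻¹ : ℝ) : ℂ) * ∑ j, A k j * h j := by
      rw [Finset.mul_sum]
      exact Finset.sum_congr rfl fun j _ => by simp only [Pi.smul_apply, smul_eq_mul]; ring
    rw [this, hAh, mul_zero, Complex.zero_re]

lemma recovers_zero {U₂ : Matrix (Fin n) (Fin n) ℂ} {lam : ℝ} (hlam : 0 ≤ lam)
    (A : Matrix (Fin m) (Fin n) ℂ) : Recovers 1 U₂ lam A 0 := by
  intro y _ hy
  obtain ⟨i, hi⟩ := Function.ne_iff.1 hy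
  have h1 : 0 < l1Norm y := Finset.sum_pos' (fun i _ => norm_nonneg _)
    ⟨i, Finset.mem_univ i, norm_pos_iff.2 hi⟩
  have h2 := mul_nonneg hlam (l1Norm_nonneg (U₂ *ᵥ y))
  have h3 : l1Norm (0 : Fin n → ℂ) = 0 := by simp [l1Norm]
  simp only [cost, one_mulVec, mulVec_zero, h3]
  linarith

lemma eventually_log_conditions :
    ∀ᶠ n : ℕ in Filter.atTop, 0 < n ∧ 2 ≤ Real.log (Real.log n) ∧ Real.log n ^ 2 ≤ √n := by
  have h1 : Filter.Tendsto (fun n : ℕ => Real.log (Real.log n)) Filter.atTop Filter.atTop :=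
    Real.tendsto_log_atTop.comp (Real.tendsto_log_atTop.comp tendsto_natCast_atTop_atTop)
  have h2 : ∀ᶠ y : ℝ in Filter.atTop, Real.log y ^ 2 ≤ √y := by
    have := (isLittleO_log_rpow_rpow_atTop (s := (1 / 2 : ℝ)) 2 (by norm_num)).bound
      (zero_lt_one (α := ℝ))
    filter_upwards [this, Filter.eventually_ge_atTop 1] with y hy h1
    rw [Real.sqrt_eq_rpow]
    rw [one_mul, Real.rpow_two, Real.norm_of_nonneg (sq_nonneg _),
      Real.norm_of_nonneg (by positivity)] at hy
    exact hy
  filter_upwards [Filter.eventually_gt_atTop 0, h1.eventually_ge_atTop 2,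
    tendsto_natCast_atTop_atTop.eventually h2] with n a b c
  exact ⟨a, b, c⟩

end Recovery

end JBP

end

/-! ### The two choices of the weight. -/

theorem theorem1 :
    ∃ C : ℝ, 0 < C ∧
      ∀ α : ℝ, 0 ≤ α → α < 1 →
      ∀ ε : ℝ, 0 < ε →
      ∃ N : ℕ, ∀ n : ℕ, N ≤ n →
      ∀ n₁ n₂ : ℕ, n = n₁ * n₂ →
      ∀ (x : Fin n → ℂ) (S₁ S₂ : Finset (Fin n)),
        S₁ = JBP.supp 1 x → S₂ = JBP.supp (JBP.dft n) x →
        S₁.card ≤ S₂.card →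
        (S₁.card : ℝ) ≤ (n : ℝ) / Real.log n →
        JBP.IsPeriodic n₁ S₁ → JBP.IsPeriodic n₂ S₂ →
        (S₂.card : ℝ) ≤ (S₁.card : ℝ) * Real.log n ^ α →
      ∀ (m : ℕ) (v : ℝ≥0), 0 < v →
        ((S₂.card : ℝ) ≤ (S₁.card : ℝ) * Real.log (Real.log n) →
          C * ((S₂.card : ℝ) * Real.log (Real.log n)) ≤ (m : ℝ) →
          JBP.gaussianMatrix m n v
            {A | ¬ JBP.Recovers 1 (JBP.dft n) 1 (Matrix.of A) x} ≤ ENNReal.ofReal ε) ∧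
        ((S₁.card : ℝ) * Real.log (Real.log n) ≤ (S₂.card : ℝ) →
          C * (S₂.card : ℝ) ≤ (m : ℝ) →
          JBP.gaussianMatrix m n v
            {A | ¬ JBP.Recovers 1 (JBP.dft n) (Real.log n)⁻¹ (Matrix.of A) x} ≤ ENNReal.ofReal ε) := by
  have hc0 := JBP.truncAbsMean_pos
  set c := JBP.truncAbsMean with hc
  -- The factor `64` comes from the escape bound, `288` from the width, and `16` from squaring `R =
  -- 4√s`.
  refine ⟨64 * 288 * 16 / c ^ 2, by positivity, ?_⟩
  intro α hα0 hα1 ε hε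
  have hlarge : ∀ᶠ n : ℕ in Filter.atTop, 1 / ε ≤ √(n : ℝ) :=
    (Real.tendsto_sqrt_atTop.comp tendsto_natCast_atTop_atTop).eventually_ge_atTop (1 / ε)
  obtain ⟨N, hN⟩ := Filter.eventually_atTop.1 (JBP.eventually_log_conditions.and hlarge)
  refine ⟨N, ?_⟩
  rintro n hn n₁ n₂ - x S₁ S₂ rfl rfl hcard - - - hα m v hv
  obtain ⟨⟨hn0, hlog, hpow⟩, hε1⟩ := hN n hn
  set L := Real.log n with hL
  have hL0 : 0 ≤ L := Real.log_natCast_nonneg n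
  have hL1 : 1 ≤ L := by
    by_contra! h
    linarith [Real.log_nonpos hL0 h.le]
  rcases eq_or_ne x 0 with rfl | hx
  -- The zero vector is handled apart, since the uncertainty principle needs `x ≠ 0`.
  · have h1 := fun A : Fin m → Fin n → ℂ =>
      JBP.recovers_zero (U₂ := JBP.dft n) zero_le_one (Matrix.of A)
    have h2 := fun A : Fin m → Fin n → ℂ =>
      JBP.recovers_zero (U₂ := JBP.dft n) (inv_nonneg.2 hL0) (Matrix.of A)
    simp [h1, h2]
  set s₁ : ℝ := ((JBP.supp 1 x).card : ℝ)
  set s₂ : ℝ := ((JBP.supp (JBP.dft n) x).card : ℝ)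
  have hs₁0 : 0 ≤ s₁ := Nat.cast_nonneg _
  have hs₂0 : 0 ≤ s₂ := Nat.cast_nonneg _
  have hs : s₁ ≤ s₂ := Nat.cast_le.2 hcard
  have hunc : (n : ℝ) ≤ s₁ * s₂ := by
    rw [← Nat.cast_mul]
    exact Nat.cast_le.2 (JBP.le_card_supp_mul_card_supp_dft hx)
  have hsqrt : √(n : ℝ) ≤ s₂ := Real.sqrt_le_iff.2 ⟨hs₂0, by nlinarith⟩
  have hs₂ : 0 < s₂ := (Real.sqrt_pos.2 (by exact_mod_cast hn0)).trans_le hsqrt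
  have hfinal : 64 * 288 * 16 / c ^ 2 * s₂ ≤ m →
      0 < m ∧ ENNReal.ofReal (4 / (m * c ^ 2)) ≤ ENNReal.ofReal ε := by
    intro hm
    have hm' : 64 * 288 * 16 * s₂ ≤ m * c ^ 2 := by
      rwa [div_mul_eq_mul_div, div_le_iff₀ (by positivity)] at hm
    have hmpos : (0 : ℝ) < m := lt_of_lt_of_le (by positivity) hm
    refine ⟨by exact_mod_cast hmpos, ENNReal.ofReal_le_ofReal ?_⟩
    rw [div_le_iff₀ (by positivity)]
    have h1 : 1 ≤ s₂ * ε := by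
      rw [← div_le_iff₀ hε]; exact hε1.trans hsqrt
    nlinarith
  constructor
  · intro _ hm
    rw [div_mul_eq_mul_div, div_le_iff₀ (by positivity)] at hm
    obtain ⟨hm0, hle⟩ := hfinal (by
      rw [div_mul_eq_mul_div, div_le_iff₀ (by positivity)]
      nlinarith)
    refine (JBP.measure_not_recovers_le hn0 hlog hpow zero_le_one (inv_le_one_of_one_le₀ hL1) x
      (R := 4 * √s₂) ?_ hm0 ?_ hv).trans hle
    · linarith [Real.sqrt_le_sqrt hs]
    · rw [mul_pow, Real.sq_sqrt hs₂0]
      linarith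
  · intro hll hm
    obtain ⟨hm0, hle⟩ := hfinal hm
    rw [div_mul_eq_mul_div, div_le_iff₀ (by positivity)] at hm
    refine (JBP.measure_not_recovers_le hn0 hlog hpow (inv_nonneg.2 hL0) le_rfl x
      (R := 4 * √s₁) ?_ hm0 ?_ hv).trans hle
    -- Since `L ^ α ≤ L ^ 2`, the weight `1 / L` brings the Fourier term of the cone down to the
    -- size `√s₁`.
    · have h1 : √s₂ ≤ √s₁ * L := by
        refine Real.sqrt_le_iff.2 ⟨by positivity, hα.trans ?_⟩
        rw [mul_pow, Real.sq_sqrt hs₁0, ← Real.rpow_two]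
        exact mul_le_mul_of_nonneg_left (Real.rpow_le_rpow_of_exponent_le hL1 (by linarith)) hs₁0
      have h2 : L⁻¹ * √s₂ ≤ √s₁ := by
        rw [inv_mul_le_iff₀ (by linarith), mul_comm]
        exact h1
      linarith
    -- The width now costs `s₁ log log n`, which the case assumption `hll` bounds by `s₂`.
    · rw [mul_pow, Real.sq_sqrt hs₁0]
      linarith
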